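/- Let $R$ be a monad on $Sets$ and $LM$ a left module over $R$ with values in $Sets$: for $f:X\to R(Y)$ there is $\rho(f):LM(X)\to LM(Y)$, with $\rho(\eta_X)=\mathrm{id}$ and $\rho(g)\rho(f)=\rho(bind(g)\circ f)$. For $E$ in $LM(\{1,\dots,n\})$ or $R(\{1,\dots,n\})$ write $E(f_1,\dots,f_n)$ for the result of substituting $f_i\in R(\{1,\dots,m\})$ for the variable $i$. **The C-system $CC(R,LM)$.** Objects are the contexts $\Gamma=(T_1,\dots,T_n)$, $n=l(\Gamma)\ge 0$, $T_i\in LM(\{1,\dots,i-1\})$. Morphisms $(E_1,\dots,E_m)\to(T_1,\dots,T_n)$ are the $n$-tuples $(f_1,\dots,f_n)\in R(\{1,\dots,m\})^n$; identities are $(1,\dots,n)$ and composition is substitution. The final object $pt$ is the empty context, $ft(T_1,\dots,T_n)=(T_1,\dots,T_{n-1})$, $ft(pt)=pt$, and $p_{(\Gamma,T)}=(1,\dots,n):(\Gamma,T)\to\Gamma$, where $n=l(\Gamma)$. For $f=(f_1,\dots,f_n):\Gamma'\to\Gamma$ with $l(\Gamma')=m$, put $f^*(\Gamma,T)=(\Gamma',T(f_1,\dots,f_n))$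 and $q(f,(\Gamma,T))=(f_1,\dots,f_n,m+1):f^*(\Gamma,T)\to(\Gamma,T)$. For $g=(g_1,\dots,g_{n+1}):\Gamma'\to(\Gamma,T)$ let $s_g=(1,\dots,m,g_{n+1}):\Gamma'\to(p_{(\Gamma,T)}\circ g)^*(\Gamma,T)$ (here $p\circ g$ is $g$ followed by $p$). Write $(\Gamma\vdash t:T)$, with $T\in LM(\{1,\dots,n\})$, $t\in R(\{1,\dots,n\})$, for the section $(1,\dots,n,t):\Gamma\to(\Gamma,T)$ of $p_{(\Gamma,T)}$, and $\partial(\Gamma\vdash t:T)=(\Gamma,T)$; these are all the sections of canonical projections. Let $CC$ be a C-subsystem of $CC(R,LM)$, that is, a set of objects and a set of morphisms closed under domains, codomains, identities, composition, $pt$, $ft$, $p$, $f^*$, $q$ and $s$. Let $C$ be its set of objects and $\widetilde C$ the set of those $(\Gamma\vdash t:T)$ which belong to $CC$. **Pairs $(Ceq,\widetilde{Ceq})$.** Let $Ceq$ be a set of sequences $(\Gamma,T,T')$, where $T,T'\in LM(\{1,\dots,l(\Gamma)\})$, and $\widetilde{Ceq}$ a set of sequences $(\Gamma,T,o,o')$,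 where $T\in LM(\{1,\dots,l(\Gamma)\})$ and $o,o'\in R(\{1,\dots,l(\Gamma)\})$. Membership in $C,\widetilde C,Ceq,\widetilde{Ceq}$ is written $(\Gamma\rhd)$, $(\Gamma\vdash t:T)$, $(\Gamma\vdash T=T')$, $(\Gamma\vdash o=o':T)$. With $n=l(\Gamma_1)$, let $t(E)$ be obtained from $E$ by replacing $j$ by $j+1$ for all variables $j>n$, and let $E[r]$, for $r\in R(\{1,\dots,n\})$, be obtained from $E$ by substituting $r$ for $n+1$ and replacing $j$ by $j-1$ for $j>n+1$; both are applied to sequences componentwise. Consider the conditions 1. (1.1) $(\rhd)$. (1.2) $(\Gamma,T\rhd)\Rightarrow(\Gamma\rhd)$. (1.3) $(\Gamma\vdash r:T)\Rightarrow(\Gamma,T\rhd)$. (1.4) $(\Gamma_1,T\rhd)\wedge(\Gamma_1,\Gamma_2\vdash r:S)\Rightarrow(\Gamma_1,T,t(\Gamma_2)\vdash t(r):t(S))$. (1.5) $(\Gamma_1\vdash r:T)\wedge(\Gamma_1,T,\Gamma_2\vdash o:S)\Rightarrow(\Gamma_1,\Gamma_2[r]\vdash o[r]:S[r])$. (1.6)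 $(\Gamma_1,T\rhd)\Rightarrow(\Gamma_1,T\vdash n+1:T)$. 2. (a) $(\Gamma\vdash T=T')\Rightarrow(\Gamma,T\rhd)$; (b) $(\Gamma,T\rhd)\Rightarrow(\Gamma\vdash T=T)$; (c) $(\Gamma\vdash T=T')\Rightarrow(\Gamma\vdash T'=T)$; (d) $(\Gamma\vdash T=T')\wedge(\Gamma\vdash T'=T'')\Rightarrow(\Gamma\vdash T=T'')$. 3. (a) $(\Gamma\vdash o=o':T)\Rightarrow(\Gamma\vdash o:T)$; (b) $(\Gamma\vdash o:T)\Rightarrow(\Gamma\vdash o=o:T)$; (c) $(\Gamma\vdash o=o':T)\Rightarrow(\Gamma\vdash o'=o:T)$; (d) $(\Gamma\vdash o=o':T)\wedge(\Gamma\vdash o'=o'':T)\Rightarrow(\Gamma\vdash o=o'':T)$. 4. (a) $(\Gamma_1\vdash T=T')\wedge(\Gamma_1,T,\Gamma_2\vdash S=S')\Rightarrow(\Gamma_1,T',\Gamma_2\vdash S=S')$; (b) $(\Gamma_1\vdash T=T')\wedge(\Gamma_1,T,\Gamma_2\vdash o=o':S)\Rightarrow(\Gamma_1,T',\Gamma_2\vdash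 o=o':S)$; (c) $(\Gamma\vdash S=S')\wedge(\Gamma\vdash o=o':S)\Rightarrow(\Gamma\vdash o=o':S')$. 5. (a) $(\Gamma_1,T\rhd)\wedge(\Gamma_1,\Gamma_2\vdash S=S')\Rightarrow(\Gamma_1,T,t(\Gamma_2)\vdash t(S)=t(S'))$; (b) $(\Gamma_1,T\rhd)\wedge(\Gamma_1,\Gamma_2\vdash o=o':S)\Rightarrow(\Gamma_1,T,t(\Gamma_2)\vdash t(o)=t(o'):t(S))$. 6. (a) $(\Gamma_1,T,\Gamma_2\vdash S=S')\wedge(\Gamma_1\vdash r:T)\Rightarrow(\Gamma_1,\Gamma_2[r]\vdash S[r]=S'[r])$; (b) $(\Gamma_1,T,\Gamma_2\vdash o=o':S)\wedge(\Gamma_1\vdash r:T)\Rightarrow(\Gamma_1,\Gamma_2[r]\vdash o[r]=o'[r]:S[r])$. 7. (a) $(\Gamma_1,T,\Gamma_2,S\rhd)\wedge(\Gamma_1\vdash r=r':T)\Rightarrow(\Gamma_1,\Gamma_2[r]\vdash S[r]=S[r'])$; (b) $(\Gamma_1,T,\Gamma_2\vdash o:S)\wedge(\Gamma_1\vdash r=r':T)\Rightarrow(\Gamma_1,\Gamma_2[r]\vdash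 o[r]=o[r']:S[r])$. Let $\mathcal A$ be the set of pairs $(Ceq,\widetilde{Ceq})$ which satisfy, together with $(C,\widetilde C)$, all the conditions (1)–(7). **Pairs $(\sim,\simeq)$.** A *regular congruence relation* on $CC$ is a pair of equivalence relations, $\sim_{Ob}$ on its objects and $\sim_{Mor}$ on its morphisms, such that: they are compatible with domain, codomain, identities, composition, $ft$, $p$, $f^*$, $q$ and $s$; $X\sim_{Ob}Y$ implies $l(X)=l(Y)$; if $l(X)>0$ and $ft(X)\sim_{Ob}F$, there is $X'\sim_{Ob}X$ with $ft(X')=F$; and for $f:X\to Y$ in $CC$, $X'\sim_{Ob}X$, $Y'\sim_{Ob}Y$, there is $f':X'\to Y'$ in $CC$ with $f'\sim_{Mor}f$. A pair of relations $(\sim,\simeq)$ on $(C,\widetilde C)$ *corresponds to* it if $\sim$ is $\sim_{Ob}$ and $\simeq$ is the restriction of $\sim_{Mor}$ to $\widetilde C$. For contexts with $l(\Gamma')\le l(\Gamma)$ let $\sigma(\Gamma,\Gamma')$ be $\Gamma$ with its initial segment of length $l(\Gamma')$ replaced by $\Gamma'$. For $\mathcal J=(\Gamma\vdash t:T)$ with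 $l(\Gamma')\le l(\partial\mathcal J)$ let $\widetilde\sigma(\mathcal J,\Gamma')$ be the section with the same term $t$ and with $\partial(\widetilde\sigma(\mathcal J,\Gamma'))=\sigma(\partial\mathcal J,\Gamma')$. Let $\mathcal B$ be the set of pairs of equivalence relations $(\sim,\simeq)$ on $(C,\widetilde C)$ such that 1. $(\sim,\simeq)$ corresponds to a regular congruence relation on $CC$; 2. if $\Gamma\in C$, $l(\Gamma)>0$ and $ft(\Gamma)\sim F$, then $\sigma(\Gamma,F)\in C$ and $\Gamma\sim\sigma(\Gamma,F)$; 3. if $\mathcal J\in\widetilde C$ and $\partial(\mathcal J)\sim F$, then $\widetilde\sigma(\mathcal J,F)\in\widetilde C$ and $\mathcal J\simeq\widetilde\sigma(\mathcal J,F)$. **Proposition.** The following two maps are well defined and are mutually inverse bijections between $\mathcal A$ and $\mathcal B$. * $\mathcal A\to\mathcal B$: $pt\sim pt$; $(\Gamma,T)\sim(\Gamma',T')$ iff $\Gamma\sim\Gamma'$ and $(\Gamma\vdash T=T')$ (contexts of different lengths are not related); $(\Gamma\vdash o:T)\simeq(\Gamma'\vdash o':T')$ iff $(\Gamma,T)\sim(\Gamma',T')$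 and $(\Gamma\vdash o=o':T)$. * $\mathcal B\to\mathcal A$: $Ceq$ is the set of $(\Gamma,T,T')$ with $(\Gamma,T),(\Gamma,T')\in C$ and $(\Gamma,T)\sim(\Gamma,T')$; $\widetilde{Ceq}$ is the set of $(\Gamma,T,o,o')$ with $(\Gamma\vdash o:T),(\Gamma\vdash o':T)\in\widetilde C$ and $(\Gamma\vdash o:T)\simeq(\Gamma\vdash o':T)$. -/

import Mathlib

universe u

namespace ContextCat

/-- A left module, with values in sets, over a monad on sets (given in Kleisli form by
`pure` and `>>=`).  `act f` is the map `ρ(f) : LM(X) → LM(Y)` of a map `f : X → R(Y)`; the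
functoriality of `LM` is the special case `f = pure ∘ h`. -/
structure LeftModule (R : Type u → Type u) [Monad R] where
  obj : Type u → Type u
  act : ∀ {X Y : Type u}, (X → R Y) → obj X → obj Y
  act_pure : ∀ {X : Type u} (E : obj X), act (pure : X → R X) E = E
  act_act : ∀ {X Y Z : Type u} (f : X → R Y) (g : Y → R Z) (E : obj X),
    act g (act f E) = act (fun x => f x >>= g) E

/-- The set `{1, …, n}`, indexed from `0`. -/
abbrev Var (n : ℕ) : Type u := ULift.{u} (Fin n)

/-- `R({1, …, n})`. -/
abbrev Tm (R : Type u → Type u) (n : ℕ) : Type u := R (Var n)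

section

variable {R : Type u → Type u} [Monad R]

/-- `LM({1, …, n})`. -/
abbrev Ty (LM : LeftModule R) (n : ℕ) : Type u := LM.obj (Var n)

/-- The variable `i` as an element of `R({1, …, n})`. -/
def var {n : ℕ} (i : Fin n) : Tm R n := pure (ULift.up i)

/-- `t(f₁/1, …, fₙ/n)`. -/
def substTm {n m : ℕ} (f : Fin n → Tm R m) (t : Tm R n) : Tm R m :=
  t >>= fun x => f x.down

/-- `E(f₁/1, …, fₙ/n)`. -/
def substTy (LM : LeftModule R) {n m : ℕ} (f : Fin n → Tm R m) (E : Ty LM n) : Ty LM m :=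
  LM.act (fun x => f x.down) E

/-! ### Contexts and judgements -/

/-- `Obₙ = LM(∅) × ⋯ × LM({1, …, n-1})`. -/
def Ctx (LM : LeftModule R) : ℕ → Type u
  | 0 => PUnit
  | n + 1 => Ctx LM n × Ty LM n

/-- Extensions `Δ = (T_{n+1}, …, T_{n+k})` of contexts of length `n`. -/
def Tele (LM : LeftModule R) (n : ℕ) : ℕ → Type u
  | 0 => PUnit
  | k + 1 => Tele LM n k × Ty LM (n + k)

/-- `(Γ, T)`. -/
def Ctx.snoc {LM : LeftModule R} {n : ℕ} (Γ : Ctx LM n) (T : Ty LM n) : Ctx LM (n + 1) :=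
  (Γ, T)

/-- `(Γ, Δ)`. -/
def Ctx.append {LM : LeftModule R} {n : ℕ} (Γ : Ctx LM n) :
    (k : ℕ) → Tele LM n k → Ctx LM (n + k)
  | 0, _ => Γ
  | k + 1, Δ => Ctx.snoc (Ctx.append Γ k Δ.1) Δ.2

/-- Objects of `CC(R,LM)`. -/
abbrev Ob (LM : LeftModule R) : Type u := Σ n : ℕ, Ctx LM n

/-- Elements `(Γ ⊢ t : T)`, written `⟨n, Γ, T, t⟩`. -/
abbrev Judg (LM : LeftModule R) : Type u := Σ n : ℕ, Ctx LM n × Ty LM n × Tm R n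

/-- Elements `(Γ ⊢ T = T')`, written `⟨n, Γ, T, T'⟩`. -/
abbrev EqTy (LM : LeftModule R) : Type u := Σ n : ℕ, Ctx LM n × Ty LM n × Ty LM n

/-- Elements `(Γ ⊢ o = o' : T)`, written `⟨n, Γ, T, o, o'⟩`. -/
abbrev EqTm (LM : LeftModule R) : Type u :=
  Σ n : ℕ, Ctx LM n × Ty LM n × Tm R n × Tm R n

/-! ### The C-system `CC(R,LM)` -/

/-- The final object, the empty context. -/
def pt (LM : LeftModule R) : Ob LM := ⟨0, PUnit.unit⟩

/-- `(X, T)`; every object of positive length is uniquely of this form. -/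
def ext {LM : LeftModule R} (X : Ob LM) (T : Ty LM X.1) : Ob LM := ⟨X.1 + 1, X.2.snoc T⟩

/-- `ft(T₁, …, Tₙ) = (T₁, …, T_{n-1})`, `ft(pt) = pt`. -/
def ft {LM : LeftModule R} : Ob LM → Ob LM
  | ⟨0, _⟩ => pt LM
  | ⟨n + 1, Γ⟩ => ⟨n, Γ.1⟩

/-- Morphisms from `X` to `Y`: elements of `R({1, …, m})ⁿ`, where `m = l(X)`, `n = l(Y)`. -/
def Hom {LM : LeftModule R} (X Y : Ob LM) : Type u := Fin Y.1 → Tm R X.1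

/-- The identity `(1, …, n)`. -/
def idHom {LM : LeftModule R} (X : Ob LM) : Hom X X := fun i => var i

/-- Composition in diagrammatic order. -/
def compHom {LM : LeftModule R} {X Y Z : Ob LM} (f : Hom X Y) (g : Hom Y Z) : Hom X Z :=
  fun i => substTm f (g i)

/-- The canonical projection `p : (X, T) → X`, i.e. `(1, …, n)`. -/
def pHom {LM : LeftModule R} (X : Ob LM) (T : Ty LM X.1) : Hom (ext X T) X :=
  fun i => var (Fin.castSucc i)

/-- The object `f^*(Y, T) = (X, T(f₁/1, …, fₙ/n))` for `f : X → Y`. -/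
def pullOb {LM : LeftModule R} {X Y : Ob LM} (f : Hom X Y) (T : Ty LM Y.1) : Ob LM :=
  ext X (substTy LM f T)

/-- The morphism `q(f, (Y, T)) = (f₁, …, fₙ, m+1) : f^*(Y, T) → (Y, T)`. -/
def qHom {LM : LeftModule R} {X Y : Ob LM} (f : Hom X Y) (T : Ty LM Y.1) :
    Hom (pullOb f T) (ext Y T) :=
  Fin.snoc (α := fun _ => Tm R (X.1 + 1))
    (fun i => substTm (fun j => var (Fin.castSucc j)) (f i)) (var (Fin.last X.1))

/-- The morphism `(1, …, m, t) : X → (X, T)`; these are the sections of `p : (X, T) → X`. -/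
def sectHom {LM : LeftModule R} (X : Ob LM) (T : Ty LM X.1) (t : Tm R X.1) :
    Hom X (ext X T) :=
  Fin.snoc (α := fun _ => Tm R X.1) (fun i => var i) t

/-- The type over `X` of which the last component of `f : X → (Y, T)` is a term:
`(f ∘ p)^*(Y, T) = (X, sTy f)`. -/
def sTy {LM : LeftModule R} {X Y : Ob LM} {T : Ty LM Y.1} (f : Hom X (ext Y T)) : Ty LM X.1 :=
  substTy LM (compHom f (pHom Y T)) T

/-- The section `s_f : X → (f ∘ p)^*(Y, T)` of `f : X → (Y, T)`. -/
def sHom {LM : LeftModule R} {X Y : Ob LM} {T : Ty LM Y.1} (f : Hom X (ext Y T)) :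
    Hom X (ext X (sTy f)) :=
  sectHom X (sTy f) (f (Fin.last Y.1))

/-- All morphisms of `CC(R,LM)`. -/
structure Mor (LM : LeftModule R) where
  dom : Ob LM
  cod : Ob LM
  map : Hom dom cod

/-- `∂(Γ ⊢ t : T) = (Γ, T)`. -/
def bd {LM : LeftModule R} (J : Judg LM) : Ob LM := ⟨J.1 + 1, J.2.1.snoc J.2.2.1⟩

/-- `(Γ ⊢ t : T)` as a morphism `Γ → (Γ, T)`. -/
def Judg.mor {LM : LeftModule R} (J : Judg LM) : Mor LM :=
  ⟨⟨J.1, J.2.1⟩, bd J, sectHom ⟨J.1, J.2.1⟩ J.2.2.1 J.2.2.2⟩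

/-- C-subsystems of `CC(R,LM)`: sub-pre-categories closed under all the operations of the
C-system. -/
structure CSubsystem (LM : LeftModule R) where
  ob : Set (Ob LM)
  mor : Set (Mor LM)
  dom_mem : ∀ f ∈ mor, f.dom ∈ ob
  cod_mem : ∀ f ∈ mor, f.cod ∈ ob
  id_mem : ∀ X ∈ ob, ⟨X, X, idHom X⟩ ∈ mor
  comp_mem : ∀ (X Y Z : Ob LM) (f : Hom X Y) (g : Hom Y Z),
    ⟨X, Y, f⟩ ∈ mor → ⟨Y, Z, g⟩ ∈ mor → ⟨X, Z, compHom f g⟩ ∈ mor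
  pt_mem : pt LM ∈ ob
  ft_mem : ∀ X ∈ ob, ft X ∈ ob
  p_mem : ∀ (X : Ob LM) (T : Ty LM X.1), ext X T ∈ ob → ⟨ext X T, X, pHom X T⟩ ∈ mor
  pull_mem : ∀ (X Y : Ob LM) (f : Hom X Y) (T : Ty LM Y.1),
    ⟨X, Y, f⟩ ∈ mor → ext Y T ∈ ob → pullOb f T ∈ ob
  q_mem : ∀ (X Y : Ob LM) (f : Hom X Y) (T : Ty LM Y.1),
    ⟨X, Y, f⟩ ∈ mor → ext Y T ∈ ob → ⟨pullOb f T, ext Y T, qHom f T⟩ ∈ mor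
  s_mem : ∀ (X Y : Ob LM) (T : Ty LM Y.1) (f : Hom X (ext Y T)),
    ⟨X, ext Y T, f⟩ ∈ mor → ⟨X, ext X (sTy f), sHom f⟩ ∈ mor

/-- The subset `C̃` of a C-subsystem: the sections of canonical projections belonging to it. -/
def CSubsystem.sec {LM : LeftModule R} (S : CSubsystem LM) : Set (Judg LM) :=
  {J | J.mor ∈ S.mor}

/-! ### Regular congruence relations -/

/-- For a relation `r` on a subset `A`: `a` and `b` belong to `A` and are related by `r`. -/
def On {α : Type u} {A : Set α} (r : A → A → Prop) (a b : α) : Prop :=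
  ∃ (ha : a ∈ A) (hb : b ∈ A), r ⟨a, ha⟩ ⟨b, hb⟩

/-- Regular congruence relations on a C-subsystem of `CC(R,LM)`. -/
structure IsRegularCongruence {LM : LeftModule R} (S : CSubsystem LM)
    (rOb : S.ob → S.ob → Prop) (rMor : S.mor → S.mor → Prop) : Prop where
  equiv_ob : Equivalence rOb
  equiv_mor : Equivalence rMor
  rel_dom : ∀ f f' : Mor LM, On rMor f f' → On rOb f.dom f'.dom
  rel_cod : ∀ f f' : Mor LM, On rMor f f' → On rOb f.cod f'.cod
  rel_id : ∀ X X' : Ob LM, On rOb X X' → On rMor ⟨X, X, idHom X⟩ ⟨X', X', idHom X'⟩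
  rel_comp : ∀ (X Y Z X' Y' Z' : Ob LM) (f : Hom X Y) (g : Hom Y Z) (f' : Hom X' Y')
    (g' : Hom Y' Z'),
    On rMor ⟨X, Y, f⟩ ⟨X', Y', f'⟩ → On rMor ⟨Y, Z, g⟩ ⟨Y', Z', g'⟩ →
      On rMor ⟨X, Z, compHom f g⟩ ⟨X', Z', compHom f' g'⟩
  rel_ft : ∀ X X' : Ob LM, On rOb X X' → On rOb (ft X) (ft X')
  rel_p : ∀ (X X' : Ob LM) (T : Ty LM X.1) (T' : Ty LM X'.1),
    On rOb (ext X T) (ext X' T') →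
      On rMor ⟨ext X T, X, pHom X T⟩ ⟨ext X' T', X', pHom X' T'⟩
  rel_pull : ∀ (X Y X' Y' : Ob LM) (f : Hom X Y) (f' : Hom X' Y') (T : Ty LM Y.1)
    (T' : Ty LM Y'.1),
    On rMor ⟨X, Y, f⟩ ⟨X', Y', f'⟩ → On rOb (ext Y T) (ext Y' T') →
      On rOb (pullOb f T) (pullOb f' T')
  rel_q : ∀ (X Y X' Y' : Ob LM) (f : Hom X Y) (f' : Hom X' Y') (T : Ty LM Y.1)
    (T' : Ty LM Y'.1),
    On rMor ⟨X, Y, f⟩ ⟨X', Y', f'⟩ → On rOb (ext Y T) (ext Y' T') →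
      On rMor ⟨pullOb f T, ext Y T, qHom f T⟩ ⟨pullOb f' T', ext Y' T', qHom f' T'⟩
  rel_s : ∀ (X Y X' Y' : Ob LM) (T : Ty LM Y.1) (T' : Ty LM Y'.1) (f : Hom X (ext Y T))
    (f' : Hom X' (ext Y' T')),
    On rMor ⟨X, ext Y T, f⟩ ⟨X', ext Y' T', f'⟩ →
      On rMor ⟨X, ext X (sTy f), sHom f⟩ ⟨X', ext X' (sTy f'), sHom f'⟩
  length_eq : ∀ X X' : Ob LM, On rOb X X' → X.1 = X'.1
  lift_ob : ∀ X F : Ob LM, X ∈ S.ob → 0 < X.1 → On rOb (ft X) F →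
    ∃ X' : Ob LM, On rOb X X' ∧ ft X' = F
  lift_mor : ∀ (X Y X' Y' : Ob LM) (f : Hom X Y), ⟨X, Y, f⟩ ∈ S.mor →
    On rOb X X' → On rOb Y Y' → ∃ f' : Hom X' Y', On rMor ⟨X, Y, f⟩ ⟨X', Y', f'⟩

/-- The pair `(∼, ≃)` of relations on `(C, C̃)` corresponds to a regular congruence relation:
it consists of the restrictions of one to objects and to sections. -/
def CorrespondsToRegularCongruence {LM : LeftModule R} (S : CSubsystem LM)
    (sim : S.ob → S.ob → Prop) (simeq : S.sec → S.sec → Prop) : Prop :=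
  ∃ rMor : S.mor → S.mor → Prop, IsRegularCongruence S sim rMor ∧
    ∀ J J' : S.sec, simeq J J' ↔ rMor ⟨J.1.mor, J.2⟩ ⟨J'.1.mor, J'.2⟩

/-! ### The operations `σ` and `σ̃` -/

/-- `σ(Γ, Γ')` replaces the initial segment of `Γ` of length `n = l(Γ')` by `Γ'`.  It is
meaningful for `l(Γ') ≤ l(Γ)` only. -/
def sigmaCtx {LM : LeftModule R} : (m : ℕ) → Ctx LM m → Ob LM → Ctx LM m
  | 0, Γ, _ => Γ
  | m + 1, Γ, F =>
    if h : F.1 = m + 1 then h ▸ F.2 else Ctx.snoc (sigmaCtx m Γ.1 F) Γ.2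

/-- `σ(Γ, Γ')`. -/
def sigma {LM : LeftModule R} (X F : Ob LM) : Ob LM := ⟨X.1, sigmaCtx X.1 X.2 F⟩

/-- `σ̃(J, Γ')` replaces the initial segment of `∂(J)` of length `l(Γ')` by `Γ'` and keeps the
term.  It is meaningful for `l(Γ') ≤ l(∂(J))` only. -/
def sigmaTilde {LM : LeftModule R} (J : Judg LM) (F : Ob LM) : Judg LM :=
  ⟨J.1, (sigmaCtx (J.1 + 1) (bd J).2 F).1, (sigmaCtx (J.1 + 1) (bd J).2 F).2, J.2.2.2⟩

/-- The pairs of equivalence relations `(∼, ≃)` on `(C, C̃)` which correspond to a regular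
congruence relation and are compatible with `σ` and `σ̃`. -/
structure IsSigmaRegular {LM : LeftModule R} (S : CSubsystem LM)
    (sim : S.ob → S.ob → Prop) (simeq : S.sec → S.sec → Prop) : Prop where
  equiv_sim : Equivalence sim
  equiv_simeq : Equivalence simeq
  regular : CorrespondsToRegularCongruence S sim simeq
  sigma_sim : ∀ X F : Ob LM, X ∈ S.ob → 0 < X.1 → On sim (ft X) F → On sim X (sigma X F)
  sigma_simeq : ∀ (J : Judg LM) (F : Ob LM), J ∈ S.sec → On sim (bd J) F →
    On simeq J (sigmaTilde J F)

/-! ### The sets `Ceq` and `C̃eq` -/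

/-- The renaming `j ↦ j` for `j ≤ n`, `j ↦ j + 1` for `j > n`. -/
def wkVar (n k : ℕ) (j : Fin (n + k)) : Fin (n + 1 + k) :=
  if j.1 < n then ⟨j.1, by omega⟩ else ⟨j.1 + 1, by omega⟩

/-- `t_{n+1}` on terms in `n + k` variables. -/
def wkTm (n k : ℕ) (t : Tm R (n + k)) : Tm R (n + 1 + k) :=
  substTm (fun j => var (wkVar n k j)) t

/-- `t_{n+1}` on types in `n + k` variables. -/
def wkTy (LM : LeftModule R) (n k : ℕ) (E : Ty LM (n + k)) : Ty LM (n + 1 + k) :=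
  substTy LM (fun j => var (wkVar n k j)) E

/-- `t_{n+1}(Δ)`. -/
def wkTele (LM : LeftModule R) (n : ℕ) : (k : ℕ) → Tele LM n k → Tele LM (n + 1) k
  | 0, _ => PUnit.unit
  | k + 1, Δ => (wkTele LM n k Δ.1, wkTy LM n k Δ.2)

/-- The substitution `j ↦ j` for `j ≤ n`, `n + 1 ↦ r`, `j ↦ j - 1` for `j > n + 1`. -/
def instVar {n : ℕ} (k : ℕ) (r : Tm R n) (j : Fin (n + 1 + k)) : Tm R (n + k) :=
  if h : j.1 < n then var ⟨j.1, by omega⟩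
  else if h' : j.1 = n then substTm (fun i => var (Fin.castAdd k i)) r
  else var ⟨j.1 - 1, by omega⟩

/-- `s_{n+1}(t[r/n+1])` for a term `t` in `n + 1 + k` variables. -/
def instTm {n : ℕ} (k : ℕ) (r : Tm R n) (t : Tm R (n + 1 + k)) : Tm R (n + k) :=
  substTm (instVar k r) t

/-- `s_{n+1}(E[r/n+1])` for a type `E` in `n + 1 + k` variables. -/
def instTy (LM : LeftModule R) {n : ℕ} (k : ℕ) (r : Tm R n) (E : Ty LM (n + 1 + k)) :
    Ty LM (n + k) :=
  substTy LM (instVar k r) E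

/-- `s_{n+1}(Δ[r/n+1])`. -/
def instTele (LM : LeftModule R) {n : ℕ} (r : Tm R n) :
    (k : ℕ) → Tele LM (n + 1) k → Tele LM n k
  | 0, _ => PUnit.unit
  | k + 1, Δ => (instTele LM r k Δ.1, instTy LM k r Δ.2)

/-- The conditions on the four sets of judgements `(Γ ▷)`, `(Γ ⊢ t : T)`, `(Γ ⊢ T = T')`,
`(Γ ⊢ o = o' : T)`. -/
structure IsJudgementSystem {LM : LeftModule R} (C : Set (Ob LM)) (Ct : Set (Judg LM))
    (Ceq : Set (EqTy LM)) (Cteq : Set (EqTm LM)) : Prop where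
  c1_1 : pt LM ∈ C
  c1_2 : ∀ (n : ℕ) (Γ : Ctx LM n) (T : Ty LM n), ⟨n + 1, Γ.snoc T⟩ ∈ C → ⟨n, Γ⟩ ∈ C
  c1_3 : ∀ (n : ℕ) (Γ : Ctx LM n) (T : Ty LM n) (r : Tm R n),
    ⟨n, Γ, T, r⟩ ∈ Ct → ⟨n + 1, Γ.snoc T⟩ ∈ C
  c1_4 : ∀ (n k : ℕ) (Γ : Ctx LM n) (T : Ty LM n) (Δ : Tele LM n k) (U : Ty LM (n + k))
    (r : Tm R (n + k)),
    ⟨n + 1, Γ.snoc T⟩ ∈ C → ⟨n + k, Γ.append k Δ, U, r⟩ ∈ Ct →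
      ⟨n + 1 + k, (Γ.snoc T).append k (wkTele LM n k Δ), wkTy LM n k U, wkTm n k r⟩ ∈ Ct
  c1_5 : ∀ (n k : ℕ) (Γ : Ctx LM n) (T : Ty LM n) (s : Tm R n) (Δ : Tele LM (n + 1) k)
    (U : Ty LM (n + 1 + k)) (r : Tm R (n + 1 + k)),
    ⟨n, Γ, T, s⟩ ∈ Ct → ⟨n + 1 + k, (Γ.snoc T).append k Δ, U, r⟩ ∈ Ct →
      ⟨n + k, Γ.append k (instTele LM s k Δ), instTy LM k s U, instTm k s r⟩ ∈ Ct
  c1_6 : ∀ (n : ℕ) (Γ : Ctx LM n) (T : Ty LM n), ⟨n + 1, Γ.snoc T⟩ ∈ C →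
    ⟨n + 1, Γ.snoc T, wkTy LM n 0 T, var (Fin.last n)⟩ ∈ Ct
  c2_a : ∀ (n : ℕ) (Γ : Ctx LM n) (T T' : Ty LM n),
    ⟨n, Γ, T, T'⟩ ∈ Ceq → ⟨n + 1, Γ.snoc T⟩ ∈ C
  c2_b : ∀ (n : ℕ) (Γ : Ctx LM n) (T : Ty LM n),
    ⟨n + 1, Γ.snoc T⟩ ∈ C → ⟨n, Γ, T, T⟩ ∈ Ceq
  c2_c : ∀ (n : ℕ) (Γ : Ctx LM n) (T T' : Ty LM n),
    ⟨n, Γ, T, T'⟩ ∈ Ceq → ⟨n, Γ, T', T⟩ ∈ Ceq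
  c2_d : ∀ (n : ℕ) (Γ : Ctx LM n) (T T' T'' : Ty LM n),
    ⟨n, Γ, T, T'⟩ ∈ Ceq → ⟨n, Γ, T', T''⟩ ∈ Ceq → ⟨n, Γ, T, T''⟩ ∈ Ceq
  c3_a : ∀ (n : ℕ) (Γ : Ctx LM n) (T : Ty LM n) (o o' : Tm R n),
    ⟨n, Γ, T, o, o'⟩ ∈ Cteq → ⟨n, Γ, T, o⟩ ∈ Ct
  c3_b : ∀ (n : ℕ) (Γ : Ctx LM n) (T : Ty LM n) (o : Tm R n),
    ⟨n, Γ, T, o⟩ ∈ Ct → ⟨n, Γ, T, o, o⟩ ∈ Cteq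
  c3_c : ∀ (n : ℕ) (Γ : Ctx LM n) (T : Ty LM n) (o o' : Tm R n),
    ⟨n, Γ, T, o, o'⟩ ∈ Cteq → ⟨n, Γ, T, o', o⟩ ∈ Cteq
  c3_d : ∀ (n : ℕ) (Γ : Ctx LM n) (T : Ty LM n) (o o' o'' : Tm R n),
    ⟨n, Γ, T, o, o'⟩ ∈ Cteq → ⟨n, Γ, T, o', o''⟩ ∈ Cteq → ⟨n, Γ, T, o, o''⟩ ∈ Cteq
  c4_a : ∀ (n k : ℕ) (Γ : Ctx LM n) (T T' : Ty LM n) (Δ : Tele LM (n + 1) k)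
    (U U' : Ty LM (n + 1 + k)),
    ⟨n, Γ, T, T'⟩ ∈ Ceq → ⟨n + 1 + k, (Γ.snoc T).append k Δ, U, U'⟩ ∈ Ceq →
      ⟨n + 1 + k, (Γ.snoc T').append k Δ, U, U'⟩ ∈ Ceq
  c4_b : ∀ (n k : ℕ) (Γ : Ctx LM n) (T T' : Ty LM n) (Δ : Tele LM (n + 1) k)
    (U : Ty LM (n + 1 + k)) (o o' : Tm R (n + 1 + k)),
    ⟨n, Γ, T, T'⟩ ∈ Ceq → ⟨n + 1 + k, (Γ.snoc T).append k Δ, U, o, o'⟩ ∈ Cteq →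
      ⟨n + 1 + k, (Γ.snoc T').append k Δ, U, o, o'⟩ ∈ Cteq
  c4_c : ∀ (n : ℕ) (Γ : Ctx LM n) (U U' : Ty LM n) (o o' : Tm R n),
    ⟨n, Γ, U, U'⟩ ∈ Ceq → ⟨n, Γ, U, o, o'⟩ ∈ Cteq → ⟨n, Γ, U', o, o'⟩ ∈ Cteq
  c5_a : ∀ (n k : ℕ) (Γ : Ctx LM n) (T : Ty LM n) (Δ : Tele LM n k) (U U' : Ty LM (n + k)),
    ⟨n + 1, Γ.snoc T⟩ ∈ C → ⟨n + k, Γ.append k Δ, U, U'⟩ ∈ Ceq →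
      ⟨n + 1 + k, (Γ.snoc T).append k (wkTele LM n k Δ), wkTy LM n k U, wkTy LM n k U'⟩ ∈ Ceq
  c5_b : ∀ (n k : ℕ) (Γ : Ctx LM n) (T : Ty LM n) (Δ : Tele LM n k) (U : Ty LM (n + k))
    (o o' : Tm R (n + k)),
    ⟨n + 1, Γ.snoc T⟩ ∈ C → ⟨n + k, Γ.append k Δ, U, o, o'⟩ ∈ Cteq →
      ⟨n + 1 + k, (Γ.snoc T).append k (wkTele LM n k Δ), wkTy LM n k U, wkTm n k o,
        wkTm n k o'⟩ ∈ Cteq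
  c6_a : ∀ (n k : ℕ) (Γ : Ctx LM n) (T : Ty LM n) (r : Tm R n) (Δ : Tele LM (n + 1) k)
    (U U' : Ty LM (n + 1 + k)),
    ⟨n + 1 + k, (Γ.snoc T).append k Δ, U, U'⟩ ∈ Ceq → ⟨n, Γ, T, r⟩ ∈ Ct →
      ⟨n + k, Γ.append k (instTele LM r k Δ), instTy LM k r U, instTy LM k r U'⟩ ∈ Ceq
  c6_b : ∀ (n k : ℕ) (Γ : Ctx LM n) (T : Ty LM n) (r : Tm R n) (Δ : Tele LM (n + 1) k)
    (U : Ty LM (n + 1 + k)) (o o' : Tm R (n + 1 + k)),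
    ⟨n + 1 + k, (Γ.snoc T).append k Δ, U, o, o'⟩ ∈ Cteq → ⟨n, Γ, T, r⟩ ∈ Ct →
      ⟨n + k, Γ.append k (instTele LM r k Δ), instTy LM k r U, instTm k r o,
        instTm k r o'⟩ ∈ Cteq
  c7_a : ∀ (n k : ℕ) (Γ : Ctx LM n) (T : Ty LM n) (r r' : Tm R n) (Δ : Tele LM (n + 1) k)
    (U : Ty LM (n + 1 + k)),
    ⟨n + 1 + k + 1, ((Γ.snoc T).append k Δ).snoc U⟩ ∈ C → ⟨n, Γ, T, r, r'⟩ ∈ Cteq →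
      ⟨n + k, Γ.append k (instTele LM r k Δ), instTy LM k r U, instTy LM k r' U⟩ ∈ Ceq
  c7_b : ∀ (n k : ℕ) (Γ : Ctx LM n) (T : Ty LM n) (r r' : Tm R n) (Δ : Tele LM (n + 1) k)
    (U : Ty LM (n + 1 + k)) (o : Tm R (n + 1 + k)),
    ⟨n + 1 + k, (Γ.snoc T).append k Δ, U, o⟩ ∈ Ct → ⟨n, Γ, T, r, r'⟩ ∈ Cteq →
      ⟨n + k, Γ.append k (instTele LM r k Δ), instTy LM k r U, instTm k r o,
        instTm k r' o⟩ ∈ Cteq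

/-! ### The two constructions -/

/-- `∼` on contexts of length `n`: `Γ ∼ Γ'` iff `ft(Γ) ∼ ft(Γ')` and
`T₁, …, T_{n-1} ⊢ Tₙ = Tₙ'`. -/
def simCtx {LM : LeftModule R} (Ceq : Set (EqTy LM)) : (n : ℕ) → Ctx LM n → Ctx LM n → Prop
  | 0, _, _ => True
  | n + 1, Γ, Γ' => simCtx Ceq n Γ.1 Γ'.1 ∧ ⟨n, Γ.1, Γ.2, Γ'.2⟩ ∈ Ceq

/-- `Γ ∼ Γ'`; only contexts of the same length are related. -/
def SimOb {LM : LeftModule R} (Ceq : Set (EqTy LM)) (X X' : Ob LM) : Prop :=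
  ∃ h : X'.1 = X.1, simCtx Ceq X.1 X.2 (h ▸ X'.2)

/-- `(Γ ⊢ o : T) ≃ (Γ' ⊢ o' : T')` iff `(Γ, T) ∼ (Γ', T')` and `Γ ⊢ o = o' : T`. -/
def SimJudg {LM : LeftModule R} (Ceq : Set (EqTy LM)) (Cteq : Set (EqTm LM))
    (J J' : Judg LM) : Prop :=
  SimOb Ceq (bd J) (bd J') ∧
    ∃ h : J'.1 = J.1, ⟨J.1, J.2.1, J.2.2.1, J.2.2.2, h ▸ J'.2.2.2⟩ ∈ Cteq

/-- The pair `(∼, ≃)` of relations on `(C, C̃)` defined by `(Ceq, C̃eq)`. -/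
def toRelations {LM : LeftModule R} (C : Set (Ob LM)) (Ct : Set (Judg LM))
    (E : Set (EqTy LM) × Set (EqTm LM)) : (C → C → Prop) × (Ct → Ct → Prop) :=
  (fun X X' => SimOb E.1 X.1 X'.1, fun J J' => SimJudg E.1 E.2 J.1 J'.1)

/-- The pair `(Ceq, C̃eq)` defined by a pair `(∼, ≃)` of relations on `(C, C̃)`. -/
def ofRelations {LM : LeftModule R} (C : Set (Ob LM)) (Ct : Set (Judg LM))
    (r : (C → C → Prop) × (Ct → Ct → Prop)) : Set (EqTy LM) × Set (EqTm LM) :=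
  ({e | On r.1 ⟨e.1 + 1, e.2.1.snoc e.2.2.1⟩ ⟨e.1 + 1, e.2.1.snoc e.2.2.2⟩},
   {e | On r.2 ⟨e.1, e.2.1, e.2.2.1, e.2.2.2.1⟩ ⟨e.1, e.2.1, e.2.2.1, e.2.2.2.2⟩})

end

end ContextCat

/-! Both directions rest on one comparison: the elementary weakenings and substitutions with a
trailing telescope `Δ` are obtained from a projection `p` or a section by iterating `q`.

From judgements to relations, two morphisms are declared related when their domains and codomains
are related and their components are equal term by term (`MorRel`, `TmRel`). The difficulty is that
the conditions speak of one weakening or one substitution at a time, whereas a congruence needs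
simultaneous substitution. The identity `f = q(p ∘ f) ∘ s_f` bridges this gap: by induction on the
codomain every pair of componentwise equal tuples is a composite of elementary pairs (`generated`),
and the substitution rules pass to composites (`rules_of_generated`). This gives `subst_eqTy` and
`subst_eqTm`, from which symmetry, transitivity and all compatibilities of `MorRel` follow.
Independence of the context, `conv_eqTy` and `conv_eqTm`, comes from replacing one type at a time.

From relations to judgements, an elementary operation on types is the pullback `f^*` along a
morphism of the subsystem, and on terms it is the pullback of a section, expressed through
composition and `s`. Compatibility of the congruence with these operations yields the substitution
conditions, except that the two sides may lie over different, related contexts. The conditions on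
`σ` and `σ̃` move both sides over the same context; they also give the conversion conditions.

The same transport makes the constructions inverse to each other: `(Γ, T) ∼ (Γ', T')` may be
compared over `Γ` alone after replacing `(Γ', T')` by `(Γ, T')`, and similarly for sections. -/

namespace ContextCat

/-! ### Substitution calculus: tuples, their lifts `q`, and elementary substitutions -/

section Substitution

variable {R : Type u → Type u} [Monad R] [LawfulMonad R]

theorem substTm_var {n m : ℕ} (f : Fin n → Tm R m) (i : Fin n) : substTm f (var i) = f i := by
  simp [substTm, var]

theorem substTm_id {n : ℕ} (t : Tm R n) : substTm (fun i => var i) t = t := by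
  simp [substTm, var]

theorem substTm_substTm {n m l : ℕ} (f : Fin n → Tm R m) (g : Fin l → Tm R n) (t : Tm R l) :
    substTm f (substTm g t) = substTm (fun i => substTm f (g i)) t := by
  simp [substTm]

end Substitution

section Substitution

variable {R : Type u → Type u} [Monad R]

theorem substTy_id {LM : LeftModule R} {n : ℕ} (E : Ty LM n) : substTy LM (fun i => var i) E = E :=
  LM.act_pure E

theorem substTy_substTy {LM : LeftModule R} {n m l : ℕ} (f : Fin n → Tm R m) (g : Fin l → Tm R n) (E : Ty LM l) :
    substTy LM f (substTy LM g E) = substTy LM (fun i => substTm f (g i)) E :=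
  LM.act_act _ _ E

/-- The tuple `(f₁, …, fₙ, m + 1)`. -/
def liftSub {n m : ℕ} (f : Fin n → Tm R m) : Fin (n + 1) → Tm R (m + 1) :=
  Fin.snoc (α := fun _ => Tm R (m + 1)) (fun i => substTm (fun j => var (Fin.castSucc j)) (f i))
    (var (Fin.last m))

/-- The tuple `(1, …, n, t)`. -/
def sectSub {n : ℕ} (t : Tm R n) : Fin (n + 1) → Tm R n :=
  Fin.snoc (α := fun _ => Tm R n) (fun i => var i) t

/-- The tuple of variables defining `wkTm` and `wkTy`. -/
def wkSub (n k : ℕ) : Fin (n + k) → Tm R (n + 1 + k) :=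
  fun j => var (wkVar n k j)

@[simp] theorem liftSub_castSucc {n m : ℕ} (f : Fin n → Tm R m) (i : Fin n) :
    liftSub f i.castSucc = substTm (fun j => var (Fin.castSucc j)) (f i) := by
  simp [liftSub]

@[simp] theorem liftSub_last {n m : ℕ} (f : Fin n → Tm R m) :
    liftSub f (Fin.last n) = var (Fin.last m) := by
  simp [liftSub]

@[simp] theorem sectSub_castSucc {n : ℕ} (t : Tm R n) (i : Fin n) :
    sectSub t i.castSucc = var i := by
  simp [sectSub]

@[simp] theorem sectSub_last {n : ℕ} (t : Tm R n) : sectSub t (Fin.last n) = t := by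
  simp [sectSub]

theorem wkSub_zero (n : ℕ) : wkSub (R := R) n 0 = fun i => var (Fin.castSucc i) := by
  funext i
  have h : wkVar n 0 i = Fin.castSucc i := by
    ext
    simp [wkVar, show i.1 < n from i.2]
  simp [wkSub, h]

end Substitution

section Substitution

variable {R : Type u → Type u} [Monad R] [LawfulMonad R]

theorem liftSub_id (n : ℕ) : liftSub (fun i : Fin n => (var i : Tm R n)) = fun i => var i := by
  funext i
  refine Fin.lastCases ?_ (fun i => ?_) i <;> simp [substTm_var]

theorem liftSub_comp {n m l : ℕ} (f : Fin n → Tm R m) (g : Fin l → Tm R n) :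
    liftSub (fun i => substTm f (g i)) = fun i => substTm (liftSub f) (liftSub g i) := by
  funext i
  refine Fin.lastCases ?_ (fun i => ?_) i
  · simp [substTm_var]
  · simp [substTm_substTm, substTm_var]

/-- `f = q(p ∘ f) ∘ s_f`. -/
theorem sectSub_liftSub {n m : ℕ} (f : Fin (n + 1) → Tm R m) :
    (fun i => substTm (sectSub (f (Fin.last n))) (liftSub (fun i => f i.castSucc) i)) = f := by
  funext i
  refine Fin.lastCases ?_ (fun i => ?_) i
  · simp [substTm_var]
  · simp [substTm_substTm, substTm_var, substTm_id]

/-- With `liftSub_instVar` below, this reduces an elementary operation under a telescope of length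
`k` to `k` applications of `q` to the case of an empty telescope. -/
theorem liftSub_wkSub (n k : ℕ) : liftSub (wkSub (R := R) n k) = wkSub n (k + 1) := by
  funext i
  refine Fin.lastCases ?_ (fun i => ?_) i
  · have : wkVar n (k + 1) (Fin.last (n + k)) = Fin.last (n + 1 + k) := by
      ext
      simp [wkVar]
      omega
    simp [wkSub, this]
  · have : wkVar n (k + 1) i.castSucc = (wkVar n k i).castSucc := by
      ext
      simp only [wkVar, Fin.val_castSucc]
      split_ifs <;> rfl
    simp [wkSub, substTm_var, this]

theorem instVar_zero {n : ℕ} (r : Tm R n) : instVar 0 r = sectSub r := by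
  funext i
  refine Fin.lastCases ?_ (fun i => ?_) i
  · simp only [sectSub_last]
    have : instVar 0 r (Fin.last n) = substTm (fun i => var (Fin.castAdd 0 i)) r := by
      simp [instVar]
    rw [this]
    exact substTm_id r
  · have h : (Fin.castSucc i).1 < n := i.2
    rw [sectSub_castSucc]
    simp only [instVar]
    rw [dif_pos h]
    rfl

theorem liftSub_instVar {n : ℕ} (k : ℕ) (r : Tm R n) :
    liftSub (instVar k r) = instVar (k + 1) r := by
  funext i
  refine Fin.lastCases ?_ (fun i => ?_) i
  · rw [liftSub_last]
    have h1 : ¬ (Fin.last (n + 1 + k)).1 < n := by simp; omega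
    have h2 : ¬ (Fin.last (n + 1 + k)).1 = n := by simp; omega
    simp only [instVar]
    rw [dif_neg h1, dif_neg h2]
    congr 1
    ext
    simp
  · rw [liftSub_castSucc]
    simp only [instVar, Fin.val_castSucc]
    split_ifs with h1 h2
    · rw [substTm_var]
      rfl
    · rw [substTm_substTm]
      simp only [substTm_var]
      rfl
    · rw [substTm_var]
      rfl

end Substitution

/-! ### Consequences of the conditions on judgements -/

section Judgements

variable {R : Type u → Type u} [Monad R] {LM : LeftModule R}

/-- `Γ ⊢ fᵢ = fᵢ' : Tᵢ(f₁, …, f_{i-1})` for the components of two tuples. -/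
def TmRel (Cteq : Set (EqTm LM)) {n : ℕ} (Γ : Ctx LM n) :
    (m : ℕ) → Ctx LM m → (Fin m → Tm R n) → (Fin m → Tm R n) → Prop
  | 0, _, _, _ => True
  | m + 1, Θ, f, f' =>
    TmRel Cteq Γ m Θ.1 (fun i => f i.castSucc) (fun i => f' i.castSucc) ∧
      ⟨n, Γ, substTy LM (fun i => f i.castSucc) Θ.2, f (Fin.last m), f' (Fin.last m)⟩ ∈ Cteq

/-- Replacement of one type of a context by an equal one. -/
inductive CtxStep (Ceq : Set (EqTy LM)) : (m : ℕ) → Ctx LM m → Ctx LM m → Prop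
  | mk (n k : ℕ) (Γ : Ctx LM n) (T T' : Ty LM n) (Δ : Tele LM (n + 1) k) :
    ⟨n, Γ, T, T'⟩ ∈ Ceq →
      CtxStep Ceq (n + 1 + k) ((Γ.snoc T).append k Δ) ((Γ.snoc T').append k Δ)

/-- Pairs of tuples obtained by composition from the elementary weakenings and the elementary
substitutions of equal terms. -/
inductive Generated (C : Set (Ob LM)) (Cteq : Set (EqTm LM)) : {n m : ℕ} → Ctx LM n → Ctx LM m →
    (Fin m → Tm R n) → (Fin m → Tm R n) → Prop
  | id {n : ℕ} (Γ : Ctx LM n) : Generated C Cteq Γ Γ (fun i => var i) (fun i => var i)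
  | comp {n m l : ℕ} {Γ : Ctx LM n} {Θ : Ctx LM m} {Ξ : Ctx LM l} {f f' : Fin m → Tm R n}
    {g g' : Fin l → Tm R m} : Generated C Cteq Γ Θ f f' → Generated C Cteq Θ Ξ g g' →
      Generated C Cteq Γ Ξ (fun i => substTm f (g i)) (fun i => substTm f' (g' i))
  | wk (n k : ℕ) (Γ : Ctx LM n) (T : Ty LM n) (Δ : Tele LM n k) : ⟨n + 1, Γ.snoc T⟩ ∈ C →
      Generated C Cteq ((Γ.snoc T).append k (wkTele LM n k Δ)) (Γ.append k Δ) (wkSub n k)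
        (wkSub n k)
  | inst (n k : ℕ) (Γ : Ctx LM n) (T : Ty LM n) (r r' : Tm R n) (Δ : Tele LM (n + 1) k) :
      ⟨n, Γ, T, r, r'⟩ ∈ Cteq →
      Generated C Cteq (Γ.append k (instTele LM r k Δ)) ((Γ.snoc T).append k Δ) (instVar k r)
        (instVar k r')

variable {C : Set (Ob LM)} {Ct : Set (Judg LM)} {Ceq : Set (EqTy LM)} {Cteq : Set (EqTm LM)}

theorem CtxStep.snoc {m : ℕ} {Γ Γ' : Ctx LM m} (h : CtxStep Ceq m Γ Γ') (U : Ty LM m) :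
    CtxStep Ceq (m + 1) (Γ.snoc U) (Γ'.snoc U) := by
  cases h with
  | mk n k Γ T T' Δ hT => exact CtxStep.mk n (k + 1) Γ T T' (Δ, U) hT

theorem reflTransGen_ctxStep {m : ℕ} {Γ Γ' : Ctx LM m} (h : simCtx Ceq m Γ Γ') :
    Relation.ReflTransGen (CtxStep Ceq m) Γ Γ' := by
  induction m with
  | zero => exact Relation.ReflTransGen.refl
  | succ m ih =>
    obtain ⟨Γ, T⟩ := Γ
    obtain ⟨Γ', T'⟩ := Γ'
    -- The equality of the last types lives over the old `Γ`, so the last type is replaced first;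
    -- the earlier types are changed afterwards, with `T'` carried along as part of the telescope.
    exact Relation.ReflTransGen.head (CtxStep.mk m 0 Γ T T' PUnit.unit h.2)
      ((ih h.1).lift (fun Γ : Ctx LM m => Γ.snoc T') fun _ _ h => CtxStep.snoc h T')

/-- Since `q` respects identities and composition, it suffices to lift the generators, and there `q`
only lengthens the telescope by `U`. -/
theorem Generated.lift [LawfulMonad R] {n m : ℕ} {Γ : Ctx LM n}
    {Θ : Ctx LM m} {f f' : Fin m → Tm R n} (h : Generated C Cteq Γ Θ f f') (U : Ty LM m) :
    Generated C Cteq (Γ.snoc (substTy LM f U)) (Θ.snoc U) (liftSub f) (liftSub f') := by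
  induction h with
  | id Γ =>
    rw [substTy_id, liftSub_id]
    exact Generated.id _
  | comp _ _ ihf ihg =>
    rw [← substTy_substTy, liftSub_comp, liftSub_comp]
    exact (ihf _).comp (ihg U)
  | wk n k Γ T Δ hT =>
    rw [liftSub_wkSub]
    exact Generated.wk n (k + 1) Γ T (Δ, U) hT
  | inst n k Γ T r r' Δ hr =>
    rw [liftSub_instVar, liftSub_instVar]
    exact Generated.inst n (k + 1) Γ T r r' (Δ, U) hr

namespace IsJudgementSystem

variable (H : IsJudgementSystem C Ct Ceq Cteq)

include H

/-- A chain of one-type replacements leads from `Γ` to `Γ'`, and each link is an instance of the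
conversion condition with a telescope. -/
theorem conv_eqTy {m : ℕ} {Γ Γ' : Ctx LM m} (h : simCtx Ceq m Γ Γ') {U U' : Ty LM m}
    (hU : ⟨m, Γ, U, U'⟩ ∈ Ceq) : ⟨m, Γ', U, U'⟩ ∈ Ceq := by
  replace h := reflTransGen_ctxStep h
  induction h with
  | refl => exact hU
  | tail _ hs ih =>
    cases hs with
    | mk n k Γ₁ T T' Δ hT => exact H.c4_a n k Γ₁ T T' Δ U U' hT ih

theorem conv_eqTm {m : ℕ} {Γ Γ' : Ctx LM m} (h : simCtx Ceq m Γ Γ') {U : Ty LM m}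
    {o o' : Tm R m} (ho : ⟨m, Γ, U, o, o'⟩ ∈ Cteq) : ⟨m, Γ', U, o, o'⟩ ∈ Cteq := by
  replace h := reflTransGen_ctxStep h
  induction h with
  | refl => exact ho
  | tail _ hs ih =>
    cases hs with
    | mk n k Γ₁ T T' Δ hT => exact H.c4_b n k Γ₁ T T' Δ U o o' hT ih

theorem simCtx_refl {m : ℕ} {Γ : Ctx LM m} (hΓ : ⟨m, Γ⟩ ∈ C) : simCtx Ceq m Γ Γ := by
  induction m with
  | zero => trivial
  | succ m ih =>
    exact ⟨ih (H.c1_2 m Γ.1 Γ.2 hΓ), H.c2_b m Γ.1 Γ.2 hΓ⟩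

theorem simCtx_symm {m : ℕ} {Γ Γ' : Ctx LM m} (h : simCtx Ceq m Γ Γ') :
    simCtx Ceq m Γ' Γ := by
  induction m with
  | zero => trivial
  -- The reversed equality of the last types is first obtained over the old context and then
  -- converted to the new one.
  | succ m ih => exact ⟨ih h.1, H.conv_eqTy h.1 (H.c2_c _ _ _ _ h.2)⟩

theorem simCtx_trans {m : ℕ} {Γ Γ' Γ'' : Ctx LM m} (h : simCtx Ceq m Γ Γ')
    (h' : simCtx Ceq m Γ' Γ'') : simCtx Ceq m Γ Γ'' := by
  induction m with
  | zero => trivial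
  | succ m ih =>
    exact ⟨ih h.1 h'.1,
      H.c2_d _ _ _ _ _ h.2 (H.conv_eqTy (H.simCtx_symm h.1) h'.2)⟩

theorem mem_of_eqTy_right {n : ℕ} {Γ : Ctx LM n} {T T' : Ty LM n}
    (h : ⟨n, Γ, T, T'⟩ ∈ Ceq) : ⟨n + 1, Γ.snoc T'⟩ ∈ C :=
  H.c2_a _ _ _ _ (H.c2_c _ _ _ _ h)

theorem mem_of_eqTm_right {n : ℕ} {Γ : Ctx LM n} {T : Ty LM n} {o o' : Tm R n}
    (h : ⟨n, Γ, T, o, o'⟩ ∈ Cteq) : ⟨n, Γ, T, o'⟩ ∈ Ct :=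
  H.c3_a _ _ _ _ _ (H.c3_c _ _ _ _ _ h)

/-- The four substitution rules for a pair of tuples `f`, `f' : Γ → Θ`. -/
theorem rules_of_generated [LawfulMonad R] {n m : ℕ} {Γ : Ctx LM n}
    {Θ : Ctx LM m} {f f' : Fin m → Tm R n} (h : Generated C Cteq Γ Θ f f') :
    (∀ U U', ⟨m, Θ, U, U'⟩ ∈ Ceq → ⟨n, Γ, substTy LM f U, substTy LM f U'⟩ ∈ Ceq) ∧
    (∀ U o o', ⟨m, Θ, U, o, o'⟩ ∈ Cteq →
      ⟨n, Γ, substTy LM f U, substTm f o, substTm f o'⟩ ∈ Cteq) ∧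
    (∀ U, ⟨m + 1, Θ.snoc U⟩ ∈ C → ⟨n, Γ, substTy LM f U, substTy LM f' U⟩ ∈ Ceq) ∧
    (∀ U o, ⟨m, Θ, U, o⟩ ∈ Ct →
      ⟨n, Γ, substTy LM f U, substTm f o, substTm f' o⟩ ∈ Cteq) := by
  induction h with
  | id Γ =>
    simp only [substTy_id, substTm_id]
    exact ⟨fun _ _ h => h, fun _ _ _ h => h, fun _ h => H.c2_b _ _ _ h,
      fun _ _ h => H.c3_b _ _ _ _ h⟩
  | comp _ _ ihf ihg =>
    obtain ⟨f1, f2, f3, f4⟩ := ihf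
    obtain ⟨g1, g2, g3, g4⟩ := ihg
    simp only [← substTy_substTy, ← substTm_substTm]
    refine ⟨fun U U' h => f1 _ _ (g1 _ _ h), fun U o o' h => f2 _ _ _ (g2 _ _ _ h),
      fun U h => ?_, fun U o h => ?_⟩
    -- The four rules are proved together because composites mix them: `f(g U) = f(g' U)` since `f`
    -- preserves equalities, and `f(g' U) = f'(g' U)` since `f` and `f'` agree on well-formed types.
    · exact H.c2_d _ _ _ _ _ (f1 _ _ (g3 _ h)) (f3 _ (H.mem_of_eqTy_right (g3 _ h)))
    · exact H.c3_d _ _ _ _ _ _ (f2 _ _ _ (g4 _ _ h)) (f4 _ _ (H.mem_of_eqTm_right (g4 _ _ h)))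
  | wk n k Γ T Δ hT =>
    refine ⟨fun U U' h => H.c5_a n k Γ T Δ U U' hT h, fun U o o' h => H.c5_b n k Γ T Δ U o o' hT h,
      fun U h => H.c5_a n k Γ T Δ U U hT (H.c2_b _ _ _ h),
      fun U o h => H.c5_b n k Γ T Δ U o o hT (H.c3_b _ _ _ _ h)⟩
  | inst n k Γ T r r' Δ hr =>
    have hr1 := H.c3_a _ _ _ _ _ hr
    exact ⟨fun U U' h => H.c6_a n k Γ T r Δ U U' h hr1,
      fun U o o' h => H.c6_b n k Γ T r Δ U o o' h hr1,
      fun U h => H.c7_a n k Γ T r r' Δ U h hr, fun U o h => H.c7_b n k Γ T r r' Δ U o h hr⟩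

/-- The empty tuple is the composite of the projections that drop the types of `Γ` one by one. -/
theorem generated_pt [LawfulMonad R] {n : ℕ} {Γ : Ctx LM n} (hΓ : ⟨n, Γ⟩ ∈ C) (Θ : Ctx LM 0)
    (f f' : Fin 0 → Tm R n) : Generated C Cteq Γ Θ f f' := by
  induction n with
  | zero =>
    rw [show f = fun i => var i from funext fun i => i.elim0,
      show f' = fun i => var i from funext fun i => i.elim0]
    exact Generated.id _
  | succ n ih =>
    have h := (Generated.wk (Cteq := Cteq) n 0 Γ.1 Γ.2 PUnit.unit hΓ).comp
      (ih (H.c1_2 n Γ.1 Γ.2 hΓ) (fun i => i.elim0) (fun i => i.elim0))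
    rw [Subsingleton.elim f _, Subsingleton.elim f' _]
    exact h

theorem generated [LawfulMonad R] {n m : ℕ} {Γ : Ctx LM n} {Θ : Ctx LM m}
    {f f' : Fin m → Tm R n} (hΓ : ⟨n, Γ⟩ ∈ C) (h : TmRel Cteq Γ m Θ f f') :
    Generated C Cteq Γ Θ f f' := by
  induction m with
  | zero => exact H.generated_pt hΓ Θ f f'
  | succ m ih =>
    -- The tuple factors as the section given by its last component followed by the lift of the
    -- remaining components.
    have h1 := (ih h.1).lift Θ.2
    have h2 := Generated.inst (C := C) n 0 Γ _ _ _ PUnit.unit h.2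
    rw [instVar_zero, instVar_zero] at h2
    have h3 := Generated.comp h2 h1
    rw [sectSub_liftSub, sectSub_liftSub] at h3
    exact h3

end IsJudgementSystem

end Judgements

/-! ### The regular congruence relation defined by equality judgements -/

section Congruence

variable {R : Type u → Type u} [Monad R] {LM : LeftModule R}
variable {C : Set (Ob LM)} {Ct : Set (Judg LM)} {Ceq : Set (EqTy LM)} {Cteq : Set (EqTm LM)}

/-- The congruence relation on morphisms. -/
inductive MorRel (Ceq : Set (EqTy LM)) (Cteq : Set (EqTm LM)) : Mor LM → Mor LM → Prop
  | mk {n m : ℕ} {Γ Γ' : Ctx LM n} {Θ Θ' : Ctx LM m} {f f' : Fin m → Tm R n} :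
    simCtx Ceq n Γ Γ' → simCtx Ceq m Θ Θ' → TmRel Cteq Γ m Θ f f' →
      MorRel Ceq Cteq ⟨⟨n, Γ⟩, ⟨m, Θ⟩, f⟩ ⟨⟨n, Γ'⟩, ⟨m, Θ'⟩, f'⟩

theorem simOb_mk {n : ℕ} {Γ Γ' : Ctx LM n} :
    SimOb Ceq ⟨n, Γ⟩ ⟨n, Γ'⟩ ↔ simCtx Ceq n Γ Γ' :=
  ⟨fun ⟨_, h⟩ => h, fun h => ⟨rfl, h⟩⟩

theorem simOb_cases {P : Ob LM → Ob LM → Prop} {X X' : Ob LM} (h : SimOb Ceq X X')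
    (hP : ∀ (n : ℕ) (Γ Γ' : Ctx LM n), simCtx Ceq n Γ Γ' → P ⟨n, Γ⟩ ⟨n, Γ'⟩) : P X X' := by
  obtain ⟨n, Γ⟩ := X
  obtain ⟨n', Γ'⟩ := X'
  obtain ⟨rfl : n' = n, h⟩ := h
  exact hP _ _ _ h

theorem CSubsystem.on_simOb (S : CSubsystem LM) {X X' : Ob LM} :
    On (fun X X' : S.ob => SimOb Ceq X.1 X'.1) X X' ↔ X ∈ S.ob ∧ X' ∈ S.ob ∧ SimOb Ceq X X' :=
  ⟨fun ⟨h, h', r⟩ => ⟨h, h', r⟩, fun ⟨h, h', r⟩ => ⟨h, h', r⟩⟩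

theorem CSubsystem.on_morRel (S : CSubsystem LM) {f f' : Mor LM} :
    On (fun f f' : S.mor => MorRel Ceq Cteq f.1 f'.1) f f' ↔
      f ∈ S.mor ∧ f' ∈ S.mor ∧ MorRel Ceq Cteq f f' :=
  ⟨fun ⟨h, h', r⟩ => ⟨h, h', r⟩, fun ⟨h, h', r⟩ => ⟨h, h', r⟩⟩

theorem CSubsystem.equivalence_simOb (S : CSubsystem LM)
    (H : IsJudgementSystem S.ob S.sec Ceq Cteq) :
    Equivalence fun X X' : S.ob => SimOb Ceq X.1 X'.1 where
  refl X := simOb_mk.2 (H.simCtx_refl X.2)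
  symm {X X'} h := simOb_cases (P := fun X X' => SimOb Ceq X' X) h
    fun _ _ _ h => simOb_mk.2 (H.simCtx_symm h)
  trans {X X' X''} h h' := by
    obtain ⟨⟨n, Γ⟩, hX⟩ := X
    obtain ⟨⟨n', Γ'⟩, hX'⟩ := X'
    obtain ⟨⟨n'', Γ''⟩, hX''⟩ := X''
    obtain ⟨rfl : n' = n, h⟩ := h
    obtain ⟨rfl : n'' = n', h'⟩ := h'
    exact simOb_mk.2 (H.simCtx_trans h h')

end Congruence

section Congruence

variable {R : Type u → Type u} [Monad R] [LawfulMonad R] {LM : LeftModule R}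
variable {C : Set (Ob LM)} {Ct : Set (Judg LM)} {Ceq : Set (EqTy LM)} {Cteq : Set (EqTm LM)}

theorem sTy_eq {n m : ℕ} (Γ : Ctx LM n) (Θ : Ctx LM m) (T : Ty LM m)
    (f : Fin (m + 1) → Tm R n) : sTy (X := ⟨n, Γ⟩) (Y := ⟨m, Θ⟩) (T := T) f =
      substTy LM (fun i => f i.castSucc) T :=
  congrArg (fun g => substTy LM g T) (funext fun _ => substTm_var _ _)

namespace IsJudgementSystem

variable (H : IsJudgementSystem C Ct Ceq Cteq)

include H

/-- Simultaneous substitution: `f U = f U'` because `f` preserves equalities, and `f U' = f' U'`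
because `f` and `f'` are equal tuples. -/
theorem subst_eqTy {n m : ℕ} {Γ : Ctx LM n} {Θ : Ctx LM m} {f f' : Fin m → Tm R n}
    (hΓ : ⟨n, Γ⟩ ∈ C) (h : TmRel Cteq Γ m Θ f f') {U U' : Ty LM m}
    (hU : ⟨m, Θ, U, U'⟩ ∈ Ceq) : ⟨n, Γ, substTy LM f U, substTy LM f' U'⟩ ∈ Ceq := by
  obtain ⟨h1, -, h3, -⟩ := H.rules_of_generated (H.generated hΓ h)
  exact H.c2_d _ _ _ _ _ (h1 _ _ hU) (h3 _ (H.mem_of_eqTy_right hU))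

theorem subst_eqTm {n m : ℕ} {Γ : Ctx LM n} {Θ : Ctx LM m} {f f' : Fin m → Tm R n}
    (hΓ : ⟨n, Γ⟩ ∈ C) (h : TmRel Cteq Γ m Θ f f') {U : Ty LM m} {o o' : Tm R m}
    (ho : ⟨m, Θ, U, o, o'⟩ ∈ Cteq) :
    ⟨n, Γ, substTy LM f U, substTm f o, substTm f' o'⟩ ∈ Cteq := by
  obtain ⟨-, h2, -, h4⟩ := H.rules_of_generated (H.generated hΓ h)
  exact H.c3_d _ _ _ _ _ _ (h2 _ _ _ ho) (h4 _ _ (H.mem_of_eqTm_right ho))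

/-- Reversal changes the type at which a component is compared from `f(T)` to `f'(T')`; these types
are equal by `subst_eqTy`, so the term equality can be converted. -/
theorem tmRel_symm {n m : ℕ} {Γ Γ' : Ctx LM n} {Θ Θ' : Ctx LM m} {f f' : Fin m → Tm R n}
    (hΓ : ⟨n, Γ⟩ ∈ C) (hs : simCtx Ceq n Γ Γ') (hs' : simCtx Ceq m Θ Θ')
    (h : TmRel Cteq Γ m Θ f f') : TmRel Cteq Γ' m Θ' f' f := by
  induction m with
  | zero => trivial
  | succ m ih =>
    exact ⟨ih hs'.1 h.1, H.conv_eqTm hs (H.c4_c _ _ _ _ _ _ (H.subst_eqTy hΓ h.1 hs'.2)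
      (H.c3_c _ _ _ _ _ h.2))⟩

theorem tmRel_trans {n m : ℕ} {Γ Γ' : Ctx LM n} {Θ Θ' : Ctx LM m} {f f' f'' : Fin m → Tm R n}
    (hΓ : ⟨n, Γ⟩ ∈ C) (hs : simCtx Ceq n Γ Γ') (hs' : simCtx Ceq m Θ Θ')
    (h : TmRel Cteq Γ m Θ f f') (h' : TmRel Cteq Γ' m Θ' f' f'') :
    TmRel Cteq Γ m Θ f f'' := by
  induction m with
  | zero => trivial
  | succ m ih =>
    exact ⟨ih hs'.1 h.1 h'.1, H.c3_d _ _ _ _ _ _ h.2 (H.c4_c _ _ _ _ _ _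
      (H.c2_c _ _ _ _ (H.subst_eqTy hΓ h.1 hs'.2)) (H.conv_eqTm (H.simCtx_symm hs) h'.2))⟩

theorem tmRel_comp {n m l : ℕ} {Γ : Ctx LM n} {Θ : Ctx LM m} {Ξ : Ctx LM l}
    {f f' : Fin m → Tm R n} {g g' : Fin l → Tm R m} (hΓ : ⟨n, Γ⟩ ∈ C)
    (h : TmRel Cteq Γ m Θ f f') (h' : TmRel Cteq Θ l Ξ g g') :
    TmRel Cteq Γ l Ξ (fun i => substTm f (g i)) (fun i => substTm f' (g' i)) := by
  induction l with
  | zero => trivial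
  | succ l ih =>
    refine ⟨ih h'.1, ?_⟩
    have := H.subst_eqTm hΓ h h'.2
    rwa [substTy_substTy] at this

end IsJudgementSystem

namespace CSubsystem

variable (S : CSubsystem LM) (H : IsJudgementSystem S.ob S.sec Ceq Cteq)

include H

/-- The last component of `f` is a term judgement because `s_f` belongs to the subsystem; the other
components are those of `p ∘ f`. -/
theorem tmRel_of_mem {n m : ℕ} {Γ : Ctx LM n} {Θ : Ctx LM m} {f : Fin m → Tm R n}
    (h : ⟨⟨n, Γ⟩, ⟨m, Θ⟩, f⟩ ∈ S.mor) : TmRel Cteq Γ m Θ f f := by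
  induction m with
  | zero => trivial
  | succ m ih =>
    obtain ⟨Θ, T⟩ := Θ
    have hp : (fun i => substTm f (var (Fin.castSucc i))) = fun i => f i.castSucc :=
      funext fun i => substTm_var _ _
    have h1 := S.comp_mem ⟨n, Γ⟩ (ext ⟨m, Θ⟩ T) ⟨m, Θ⟩ f (pHom ⟨m, Θ⟩ T) h
      (S.p_mem ⟨m, Θ⟩ T (S.cod_mem _ h))
    have h2 := S.s_mem ⟨n, Γ⟩ ⟨m, Θ⟩ T f h
    refine ⟨ih (Θ := Θ) (hp ▸ h1), H.c3_b _ _ _ _ ?_⟩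
    have h3 : (⟨n, Γ, substTy LM (fun i => substTm f (var (Fin.castSucc i))) T,
      f (Fin.last m)⟩ : Judg LM) ∈ S.sec := h2
    rwa [hp] at h3

/-- Conversely, a tuple of well-typed components is rebuilt inside the subsystem from sections and
lifts; over the empty context it is a composite of projections. -/
theorem mem_of_tmRel {n m : ℕ} {Γ : Ctx LM n} {Θ : Ctx LM m} {f f' : Fin m → Tm R n}
    (hΓ : ⟨n, Γ⟩ ∈ S.ob) (hΘ : ⟨m, Θ⟩ ∈ S.ob) (h : TmRel Cteq Γ m Θ f f') :
    ⟨⟨n, Γ⟩, ⟨m, Θ⟩, f⟩ ∈ S.mor := by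
  induction m with
  | zero =>
    clear h
    induction n with
    | zero =>
      rw [Subsingleton.elim f (fun i => var i)]
      exact S.id_mem ⟨0, Γ⟩ hΓ
    | succ n ih =>
      have h := S.comp_mem _ _ _ _ _ (S.p_mem ⟨n, Γ.1⟩ Γ.2 hΓ)
        (ih (S.ft_mem _ hΓ) (f := fun i => i.elim0) (f' := fun i => i.elim0))
      rw [Subsingleton.elim f _]
      exact h
  | succ m ih =>
    obtain ⟨Θ, T⟩ := Θ
    have h1 := S.q_mem ⟨n, Γ⟩ ⟨m, Θ⟩ _ T (ih (S.ft_mem _ hΘ) h.1) hΘ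
    have h2 : Judg.mor _ ∈ S.mor := H.c3_a _ _ _ _ _ h.2
    have h3 := S.comp_mem _ _ _ _ _ h2 h1
    rw [← sectSub_liftSub f]
    exact h3

theorem tmRel_id {n : ℕ} {Γ : Ctx LM n} (hΓ : ⟨n, Γ⟩ ∈ S.ob) :
    TmRel Cteq Γ n Γ (fun i => var i) (fun i => var i) :=
  S.tmRel_of_mem H (S.id_mem ⟨n, Γ⟩ hΓ)

theorem equivalence_morRel :
    Equivalence fun f f' : S.mor => MorRel Ceq Cteq f.1 f'.1 where
  refl f := ⟨H.simCtx_refl (S.dom_mem _ f.2), H.simCtx_refl (S.cod_mem _ f.2),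
    S.tmRel_of_mem H f.2⟩
  symm {f f'} h := by
    obtain ⟨f, hf⟩ := f
    obtain ⟨f', hf'⟩ := f'
    obtain ⟨h1, h2, h3⟩ : MorRel Ceq Cteq f f' := h
    exact ⟨H.simCtx_symm h1, H.simCtx_symm h2, H.tmRel_symm (S.dom_mem _ hf) h1 h2 h3⟩
  trans {f f' f''} h h' := by
    obtain ⟨f, hf⟩ := f
    obtain ⟨f', hf'⟩ := f'
    obtain ⟨f'', hf''⟩ := f''
    obtain ⟨h1, h2, h3⟩ : MorRel Ceq Cteq f f' := h
    obtain ⟨h1', h2', h3'⟩ : MorRel Ceq Cteq _ f'' := h'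
    exact ⟨H.simCtx_trans h1 h1', H.simCtx_trans h2 h2',
      H.tmRel_trans (S.dom_mem _ hf) h1 h2 h3 h3'⟩

theorem isRegularCongruence : IsRegularCongruence S (fun X X' => SimOb Ceq X.1 X'.1)
    (fun f f' => MorRel Ceq Cteq f.1 f'.1) where
  equiv_ob := S.equivalence_simOb H
  equiv_mor := S.equivalence_morRel H
  rel_dom f f' h := by
    obtain ⟨hf, hf', h⟩ := S.on_morRel.1 h
    refine S.on_simOb.2 ⟨S.dom_mem _ hf, S.dom_mem _ hf', ?_⟩
    obtain ⟨h1, h2, h3⟩ := h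
    exact simOb_mk.2 h1
  rel_cod f f' h := by
    obtain ⟨hf, hf', h⟩ := S.on_morRel.1 h
    refine S.on_simOb.2 ⟨S.cod_mem _ hf, S.cod_mem _ hf', ?_⟩
    obtain ⟨h1, h2, h3⟩ := h
    exact simOb_mk.2 h2
  rel_id X X' h := by
    obtain ⟨hX, hX', h⟩ := S.on_simOb.1 h
    refine S.on_morRel.2 ⟨S.id_mem _ hX, S.id_mem _ hX', ?_⟩
    revert hX
    refine simOb_cases (P := fun X X' => X ∈ S.ob → MorRel Ceq Cteq ⟨X, X, idHom X⟩
      ⟨X', X', idHom X'⟩) h fun n Γ Γ' h hX => ?_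
    exact ⟨h, h, S.tmRel_id H hX⟩
  rel_comp X Y Z X' Y' Z' f g f' g' h h' := by
    obtain ⟨hf, hf', h⟩ := S.on_morRel.1 h
    obtain ⟨hg, hg', h'⟩ := S.on_morRel.1 h'
    refine S.on_morRel.2 ⟨S.comp_mem _ _ _ _ _ hf hg, S.comp_mem _ _ _ _ _ hf' hg', ?_⟩
    have hX := S.dom_mem _ hf
    obtain ⟨h1, h2, h3⟩ := h
    obtain ⟨h1', h2', h3'⟩ := h'
    exact ⟨h1, h2', H.tmRel_comp hX h3 h3'⟩
  rel_ft X X' h := by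
    obtain ⟨hX, hX', h⟩ := S.on_simOb.1 h
    refine S.on_simOb.2 ⟨S.ft_mem _ hX, S.ft_mem _ hX', ?_⟩
    refine simOb_cases (P := fun X X' => SimOb Ceq (ft X) (ft X')) h fun n Γ Γ' h => ?_
    cases n with
    | zero => exact simOb_mk.2 h
    | succ n => exact simOb_mk.2 h.1
  rel_p X X' T T' h := by
    obtain ⟨hX, hX', h⟩ := S.on_simOb.1 h
    have hp := S.p_mem _ _ hX
    refine S.on_morRel.2 ⟨hp, S.p_mem _ _ hX', ?_⟩
    obtain ⟨n, Γ⟩ := X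
    obtain ⟨n', Γ'⟩ := X'
    obtain rfl : n' = n := Nat.succ_injective h.1
    have h := simOb_mk.1 h
    exact ⟨h, h.1, S.tmRel_of_mem H hp⟩
  rel_pull X Y X' Y' f f' T T' h h' := by
    obtain ⟨hf, hf', h⟩ := S.on_morRel.1 h
    obtain ⟨hY, hY', h'⟩ := S.on_simOb.1 h'
    refine S.on_simOb.2 ⟨S.pull_mem _ _ _ _ hf hY, S.pull_mem _ _ _ _ hf' hY', ?_⟩
    have hX := S.dom_mem _ hf
    obtain ⟨h1, h2, h3⟩ := h
    have h' := simOb_mk.1 h'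
    exact simOb_mk.2 ⟨h1, H.subst_eqTy hX h3 h'.2⟩
  rel_q X Y X' Y' f f' T T' h h' := by
    obtain ⟨hf, hf', h⟩ := S.on_morRel.1 h
    obtain ⟨hY, hY', h'⟩ := S.on_simOb.1 h'
    have hq := S.q_mem _ _ _ _ hf hY
    have hfT := S.pull_mem _ _ _ _ hf hY
    have hp := S.p_mem _ _ hfT
    refine S.on_morRel.2 ⟨hq, S.q_mem _ _ _ _ hf' hY', ?_⟩
    have hX := S.dom_mem _ hf
    obtain ⟨h1, h2, h3⟩ := h
    have h' := simOb_mk.1 h'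
    refine ⟨⟨h1, H.subst_eqTy hX h3 h'.2⟩, h', ?_⟩
    have hq' := S.tmRel_of_mem H hq
    refine ⟨?_, ?_⟩
    -- The first components of `q(f)` are those of `f` precomposed with the projection; the last one
    -- is the same variable on both sides, so reflexivity for `q(f)` suffices there.
    · have h4 := H.tmRel_comp hfT (S.tmRel_of_mem H hp) h3
      simp only [qHom, Fin.snoc_castSucc]
      exact h4
    · have h5 := hq'.2
      simp only [qHom, Fin.snoc_last] at h5 ⊢
      exact h5
  rel_s X Y X' Y' T T' f f' h := by
    obtain ⟨hf, hf', h⟩ := S.on_morRel.1 h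
    have hs := S.s_mem _ _ _ _ hf
    refine S.on_morRel.2 ⟨hs, S.s_mem _ _ _ _ hf', ?_⟩
    have hX := S.dom_mem _ hf
    obtain ⟨m, Θ⟩ := Y
    obtain ⟨m', Θ'⟩ := Y'
    obtain @⟨n, _, Γ, Γ', _, _, _, f', h1, h2, h3⟩ := h
    have e := sTy_eq Γ Θ T f
    have e' := sTy_eq Γ' Θ' T' f'
    refine ⟨h1, ⟨h1, ?_⟩, ?_, ?_⟩
    · exact (congrArg₂ (fun A B => (⟨n, Γ, A, B⟩ : EqTy LM) ∈ Ceq) e e').mpr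
        (H.subst_eqTy hX h3.1 h2.2)
    · simp only [sHom, sectHom, Fin.snoc_castSucc]
      exact S.tmRel_id H hX
    · simp only [sHom, sectHom, Fin.snoc_castSucc, Fin.snoc_last]
      exact (congrArg (fun A => (⟨n, Γ, A, f (Fin.last m), f' (Fin.last m)⟩ : EqTm LM) ∈ Cteq)
        ((substTy_id _).trans e)).mpr h3.2
  length_eq X X' h := by
    obtain ⟨-, -, h, -⟩ := S.on_simOb.1 h
    exact h.symm
  lift_ob X F hX hl h := by
    obtain ⟨n, Γ⟩ := X
    obtain ⟨m, Γ'⟩ := F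
    cases n with
    | zero => exact absurd hl (lt_irrefl 0)
    | succ n =>
      obtain ⟨-, -, h⟩ := S.on_simOb.1 h
      obtain ⟨rfl : m = n, h⟩ := h
      obtain ⟨Γ, T⟩ := Γ
      have hT := H.c2_b _ _ _ hX
      exact ⟨⟨m + 1, Ctx.snoc Γ' T⟩, S.on_simOb.2 ⟨hX, H.c2_a _ _ _ _ (H.conv_eqTy h hT),
        simOb_mk.2 ⟨h, hT⟩⟩, rfl⟩
  lift_mor X Y X' Y' f hf h h' := by
    obtain ⟨hX, hX', h⟩ := S.on_simOb.1 h
    obtain ⟨hY, hY', h'⟩ := S.on_simOb.1 h'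
    obtain ⟨n, Γ⟩ := X
    obtain ⟨n', Γ'⟩ := X'
    obtain ⟨m, Θ⟩ := Y
    obtain ⟨m', Θ'⟩ := Y'
    obtain ⟨rfl : n' = n, h⟩ := h
    obtain ⟨rfl : m' = m, h'⟩ := h'
    have hr := S.tmRel_of_mem H hf
    -- The lift is the same tuple `f`, read between the new contexts; symmetry of `TmRel` supplies
    -- its typing there.
    exact ⟨f, S.on_morRel.2 ⟨hf, S.mem_of_tmRel H hX' hY' (H.tmRel_symm hX h h' hr),
      ⟨h, h', hr⟩⟩⟩

end CSubsystem

end Congruence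

/-! ### The operations `σ` and `σ̃` -/

section Sigma

variable {R : Type u → Type u} [Monad R] {LM : LeftModule R}

/-- Related contexts have equal lengths, so `σ` is only needed with `l(F) = l(Γ) - 1` and `σ̃` only
with `l(F) = l(∂J)`; this lemma and the next compute these cases. -/
theorem sigmaCtx_same_length {n : ℕ} (Γ Γ' : Ctx LM n) : sigmaCtx n Γ ⟨n, Γ'⟩ = Γ' := by
  cases n with
  | zero => rfl
  | succ n => simp [sigmaCtx]

theorem sigmaCtx_snoc {n : ℕ} (Γ Γ' : Ctx LM n) (T : Ty LM n) :
    sigmaCtx (n + 1) (Γ.snoc T) ⟨n, Γ'⟩ = Γ'.snoc T := by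
  have h : ¬ n = n + 1 := by omega
  simp only [sigmaCtx]
  rw [dif_neg h]
  exact congrArg (fun Γ => Ctx.snoc Γ T) (sigmaCtx_same_length Γ Γ')

theorem sigma_snoc {n : ℕ} (Γ Γ' : Ctx LM n) (T : Ty LM n) :
    sigma ⟨n + 1, Γ.snoc T⟩ ⟨n, Γ'⟩ = ⟨n + 1, Γ'.snoc T⟩ :=
  congrArg (Sigma.mk (n + 1)) (sigmaCtx_snoc Γ Γ' T)

theorem sigmaTilde_mk {n : ℕ} (Γ Γ' : Ctx LM n) (T T' : Ty LM n) (o : Tm R n) :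
    sigmaTilde ⟨n, Γ, T, o⟩ ⟨n + 1, Γ'.snoc T'⟩ = ⟨n, Γ', T', o⟩ :=
  congrArg (fun Θ : Ctx LM (n + 1) => (⟨n, Θ.1, Θ.2, o⟩ : Judg LM))
    (sigmaCtx_same_length (Γ.snoc T) (Γ'.snoc T'))

end Sigma

/-! ### From equality judgements to relations -/

section ToRelations

variable {R : Type u → Type u} [Monad R] {LM : LeftModule R}

theorem ofRelations_toRelations (S : CSubsystem LM)
    {E : Set (EqTy LM) × Set (EqTm LM)}
    (H : IsJudgementSystem S.ob S.sec E.1 E.2) :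
    ofRelations S.ob S.sec (toRelations S.ob S.sec E) = E := by
  refine Prod.ext (Set.ext fun e => ?_) (Set.ext fun e => ?_)
  · obtain ⟨n, Γ, T, T'⟩ := e
    refine ⟨fun ⟨_, _, h⟩ => (simOb_mk.1 h).2, fun h => ?_⟩
    have hT := H.c2_a _ _ _ _ h
    exact ⟨hT, H.mem_of_eqTy_right h, simOb_mk.2 ⟨H.simCtx_refl (H.c1_2 _ _ _ hT), h⟩⟩
  · obtain ⟨n, Γ, T, o, o'⟩ := e
    refine ⟨fun ⟨_, _, _, _, h⟩ => h, fun h => ?_⟩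
    have ho := H.c3_a _ _ _ _ _ h
    exact ⟨ho, H.mem_of_eqTm_right h, simOb_mk.2 (H.simCtx_refl (H.c1_3 _ _ _ _ ho)), rfl, h⟩

end ToRelations

section ToRelations

variable {R : Type u → Type u} [Monad R] [LawfulMonad R] {LM : LeftModule R}
variable {Ceq : Set (EqTy LM)} {Cteq : Set (EqTm LM)}

namespace CSubsystem

variable (S : CSubsystem LM) (H : IsJudgementSystem S.ob S.sec Ceq Cteq)

include H

theorem tmRel_sectHom_iff {n : ℕ} {Γ : Ctx LM n} {T T' : Ty LM n} {o o' : Tm R n}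
    (hΓ : ⟨n, Γ⟩ ∈ S.ob) :
    TmRel Cteq Γ (n + 1) (Γ.snoc T) (sectHom ⟨n, Γ⟩ T o) (sectHom ⟨n, Γ⟩ T' o') ↔
      ⟨n, Γ, T, o, o'⟩ ∈ Cteq := by
  simp only [TmRel, sectHom, Fin.snoc_castSucc, Fin.snoc_last]
  refine (and_iff_right (S.tmRel_id H hΓ)).trans ?_
  exact iff_of_eq (congrArg (fun A => (⟨n, Γ, A, o, o'⟩ : EqTm LM) ∈ Cteq) (substTy_id T))

/-- The first `n` entries of a section are those of the identity, so only the last one carries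
information; hence `≃` is the restriction of `MorRel` to sections. -/
theorem simJudg_iff {J J' : Judg LM} (hJ : J ∈ S.sec) :
    SimJudg Ceq Cteq J J' ↔ MorRel Ceq Cteq J.mor J'.mor := by
  obtain ⟨n, Γ, T, o⟩ := J
  obtain ⟨n', Γ', T', o'⟩ := J'
  have hΓ : ⟨n, Γ⟩ ∈ S.ob := S.dom_mem _ hJ
  constructor
  · rintro ⟨h1, rfl : n' = n, h2⟩
    have h1 := simOb_mk.1 h1
    exact ⟨h1.1, h1, (S.tmRel_sectHom_iff (T' := T') H hΓ).2 h2⟩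
  · intro h
    simp only [Judg.mor, bd] at h
    obtain @⟨_, _, _, _, _, _, _, _, h1, h2, h3⟩ := h
    exact ⟨simOb_mk.2 h2, rfl, (S.tmRel_sectHom_iff (T' := T') H hΓ).1 h3⟩

theorem isSigmaRegular :
    IsSigmaRegular S (toRelations S.ob S.sec (Ceq, Cteq)).1
      (toRelations S.ob S.sec (Ceq, Cteq)).2 where
  equiv_sim := S.equivalence_simOb H
  equiv_simeq :=
    have E := (S.equivalence_morRel H).comap fun J : S.sec => (⟨J.1.mor, J.2⟩ : S.mor)
    { refl J := (S.simJudg_iff H J.2).2 (E.refl J)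
      symm {J J'} h := (S.simJudg_iff H J'.2).2 (E.symm ((S.simJudg_iff H J.2).1 h))
      trans {J J' J''} h h' := (S.simJudg_iff H J.2).2
        (E.trans ((S.simJudg_iff H J.2).1 h) ((S.simJudg_iff H J'.2).1 h')) }
  regular := ⟨_, S.isRegularCongruence H, fun J _ => S.simJudg_iff H J.2⟩
  sigma_sim X F hX hl h := by
    obtain ⟨n, Γ⟩ := X
    obtain ⟨m, Γ'⟩ := F
    cases n with
    | zero => exact absurd hl (lt_irrefl 0)
    | succ n =>
      obtain ⟨-, -, h⟩ := S.on_simOb.1 h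
      obtain ⟨rfl : m = n, h⟩ := h
      obtain ⟨Γ, T⟩ := Γ
      have hT := H.c2_b _ _ _ hX
      refine S.on_simOb.2 ⟨hX, ?_⟩
      have e : sigma ⟨m + 1, (Γ, T)⟩ ⟨m, Γ'⟩ = ⟨m + 1, Γ'.snoc T⟩ := sigma_snoc Γ Γ' T
      rw [e]
      exact ⟨H.c2_a _ _ _ _ (H.conv_eqTy h hT), simOb_mk.2 ⟨h, hT⟩⟩
  sigma_simeq J F hJ h := by
    obtain ⟨n, Γ, T, o⟩ := J
    obtain ⟨m, Γ'⟩ := F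
    obtain ⟨-, -, h⟩ := S.on_simOb.1 h
    obtain ⟨rfl : m = n + 1, h⟩ := h
    obtain ⟨Γ', T'⟩ := Γ'
    have e : sigmaTilde ⟨n, Γ, T, o⟩ ⟨n + 1, (Γ', T')⟩ = ⟨n, Γ', T', o⟩ :=
      sigmaTilde_mk Γ Γ' T T' o
    rw [e]
    -- The reflexive equality `o = o` is converted to the type `T'` and then to the context `Γ'`;
    -- its left half is the required membership.
    have ho := H.c3_b _ _ _ _ hJ
    exact ⟨hJ, H.c3_a _ _ _ _ _ (H.conv_eqTm h.1 (H.c4_c _ _ _ _ _ _ h.2 ho)),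
      simOb_mk.2 h, rfl, ho⟩

end CSubsystem

end ToRelations

/-! ### From relations to equality judgements -/

section On

variable {α : Type u} {A : Set α} {r : A → A → Prop}

theorem On.left {a b : α} (h : On r a b) : a ∈ A := h.1

theorem On.right {a b : α} (h : On r a b) : b ∈ A := h.2.1

theorem On.refl (hr : Equivalence r) {a : α} (ha : a ∈ A) : On r a a :=
  ⟨ha, ha, hr.refl _⟩

theorem On.symm (hr : Equivalence r) {a b : α} (h : On r a b) : On r b a :=
  let ⟨ha, hb, h⟩ := h
  ⟨hb, ha, hr.symm h⟩

theorem On.trans (hr : Equivalence r) {a b c : α} (h : On r a b) (h' : On r b c) : On r a c :=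
  let ⟨ha, _, h⟩ := h
  let ⟨_, hc, h'⟩ := h'
  ⟨ha, hc, hr.trans h h'⟩

end On

/-! ### Transport along `σ` and `σ̃`, and recovery of the relations -/

section OfRelations

variable {R : Type u → Type u} [Monad R] {LM : LeftModule R} {S : CSubsystem LM}

namespace IsSigmaRegular

variable {sim : S.ob → S.ob → Prop} {simeq : S.sec → S.sec → Prop}
variable (K : IsSigmaRegular S sim simeq)

include K

theorem conv_ob {n : ℕ} {Γ Γ' : Ctx LM n} {U : Ty LM n} (h : On sim ⟨n, Γ⟩ ⟨n, Γ'⟩)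
    (hU : ⟨n + 1, Γ.snoc U⟩ ∈ S.ob) :
    On sim ⟨n + 1, Γ.snoc U⟩ ⟨n + 1, Γ'.snoc U⟩ := by
  have := K.sigma_sim _ _ hU (Nat.succ_pos n) h
  rwa [sigma_snoc] at this

theorem conv_append {n k : ℕ} {Γ Γ' : Ctx LM n} {Δ : Tele LM n k}
    (h : On sim ⟨n, Γ⟩ ⟨n, Γ'⟩) (hΔ : ⟨n + k, Γ.append k Δ⟩ ∈ S.ob) :
    On sim ⟨n + k, Γ.append k Δ⟩ ⟨n + k, Γ'.append k Δ⟩ := by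
  induction k with
  | zero => exact h
  | succ k ih => exact K.conv_ob (ih (S.ft_mem _ hΔ)) hΔ

theorem conv_sec {n : ℕ} {Γ Γ' : Ctx LM n} {U U' : Ty LM n} {o : Tm R n}
    (h : On sim ⟨n + 1, Γ.snoc U⟩ ⟨n + 1, Γ'.snoc U'⟩) (ho : ⟨n, Γ, U, o⟩ ∈ S.sec) :
    On simeq ⟨n, Γ, U, o⟩ ⟨n, Γ', U', o⟩ := by
  have := K.sigma_simeq _ _ ho h
  rwa [sigmaTilde_mk] at this

theorem bd_rel {J J' : Judg LM} (h : On simeq J J') : On sim (bd J) (bd J') := by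
  obtain ⟨rMor, G, hG⟩ := K.regular
  obtain ⟨hJ, hJ', h⟩ := h
  exact G.rel_cod _ _ ⟨hJ, hJ', (hG _ _).1 h⟩

theorem simOb_ofRelations_iff {X X' : Ob LM} (hX : X ∈ S.ob) (hX' : X' ∈ S.ob) :
    SimOb (ofRelations S.ob S.sec (sim, simeq)).1 X X' ↔ On sim X X' := by
  obtain ⟨_, G, -⟩ := K.regular
  suffices h : ∀ (n : ℕ) (Γ Γ' : Ctx LM n), ⟨n, Γ⟩ ∈ S.ob → ⟨n, Γ'⟩ ∈ S.ob →
      (simCtx (ofRelations S.ob S.sec (sim, simeq)).1 n Γ Γ' ↔ On sim ⟨n, Γ⟩ ⟨n, Γ'⟩) by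
    obtain ⟨n, Γ⟩ := X
    obtain ⟨n', Γ'⟩ := X'
    constructor
    · rintro ⟨rfl : n' = n, h'⟩
      exact (h _ _ _ hX hX').1 h'
    · intro h'
      obtain rfl : n = n' := G.length_eq _ _ h'
      exact simOb_mk.2 ((h _ _ _ hX hX').2 h')
  intro n
  induction n with
  | zero => exact fun Γ Γ' hΓ _ => ⟨fun _ => On.refl K.equiv_sim hΓ, fun _ => trivial⟩
  | succ n ih =>
    rintro ⟨Γ, T⟩ ⟨Γ', T'⟩ hΓ hΓ'
    have ih := ih Γ Γ' (S.ft_mem _ hΓ) (S.ft_mem _ hΓ')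
    constructor
    · rintro ⟨h1, h2⟩
      -- The intermediate context is `(Γ, T')`: it is related to `(Γ, T)` by the equality judgement
      -- and to `(Γ', T')` by `σ`. The converse uses the same triangle.
      exact On.trans K.equiv_sim h2 (K.conv_ob (ih.1 h1) (On.right h2))
    · intro h
      have h1 := G.rel_ft _ _ h
      exact ⟨ih.2 h1, h.trans K.equiv_sim (K.conv_ob (h1.symm K.equiv_sim) hΓ')⟩

theorem simJudg_ofRelations_iff {J J' : Judg LM} (hJ : J ∈ S.sec) (hJ' : J' ∈ S.sec) :
    SimJudg (ofRelations S.ob S.sec (sim, simeq)).1 (ofRelations S.ob S.sec (sim, simeq)).2 J J' ↔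
      On simeq J J' := by
  obtain ⟨_, G, -⟩ := K.regular
  have hbd := K.simOb_ofRelations_iff (S.cod_mem _ hJ) (S.cod_mem _ hJ')
  obtain ⟨n, Γ, T, o⟩ := J
  obtain ⟨n', Γ', T', o'⟩ := J'
  constructor
  · rintro ⟨h1, rfl : n' = n, h2⟩
    exact On.trans K.equiv_simeq h2 (K.conv_sec (hbd.1 h1) (On.right h2))
  · intro h
    have h1 := K.bd_rel h
    obtain rfl : n = n' := Nat.succ_injective (G.length_eq _ _ h1)
    exact ⟨hbd.2 h1, rfl, h.trans K.equiv_simeq (K.conv_sec (h1.symm K.equiv_sim) hJ')⟩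

theorem toRelations_ofRelations :
    toRelations S.ob S.sec (ofRelations S.ob S.sec (sim, simeq)) = (sim, simeq) := by
  refine Prod.ext (funext fun X => funext fun X' => propext ?_)
    (funext fun J => funext fun J' => propext ?_)
  · exact (K.simOb_ofRelations_iff X.2 X'.2).trans ⟨fun ⟨_, _, h⟩ => h, fun h => ⟨_, _, h⟩⟩
  · exact (K.simJudg_ofRelations_iff J.2 J'.2).trans ⟨fun ⟨_, _, h⟩ => h, fun h => ⟨_, _, h⟩⟩

end IsSigmaRegular

end OfRelations

/-! ### Elementary substitutions as morphisms, and the conditions on judgements -/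

section OfRelations

variable {R : Type u → Type u} [Monad R] [LawfulMonad R] {LM : LeftModule R}
variable {S : CSubsystem LM}

theorem CSubsystem.wkSub_mem (S : CSubsystem LM) {n k : ℕ} {Γ : Ctx LM n} {T : Ty LM n}
    {Δ : Tele LM n k} (hT : ⟨n + 1, Γ.snoc T⟩ ∈ S.ob) (hΔ : ⟨n + k, Γ.append k Δ⟩ ∈ S.ob) :
    ⟨⟨n + 1 + k, (Γ.snoc T).append k (wkTele LM n k Δ)⟩, ⟨n + k, Γ.append k Δ⟩, wkSub n k⟩ ∈
      S.mor := by
  induction k with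
  | zero =>
    rw [wkSub_zero]
    exact S.p_mem ⟨n, Γ⟩ T hT
  | succ k ih =>
    obtain ⟨Δ, U⟩ := Δ
    rw [← liftSub_wkSub]
    exact S.q_mem _ ⟨n + k, Γ.append k Δ⟩ _ U (ih (S.ft_mem _ hΔ)) hΔ

/-- Pulling a section back along a morphism. -/
theorem sHom_compHom_sectHom {X Y : Ob LM} (f : Hom X Y) (U : Ty LM Y.1) (o : Tm R Y.1) :
    (⟨X, ext X (sTy (compHom f (sectHom Y U o))), sHom (compHom f (sectHom Y U o))⟩ : Mor LM) =
      Judg.mor ⟨X.1, X.2, substTy LM f U, substTm f o⟩ := by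
  have e1 : sTy (compHom f (sectHom Y U o)) = substTy LM f U :=
    congrArg (fun g => substTy LM g U) (funext fun i =>
      (substTm_var _ _).trans ((congrArg (substTm f) (sectSub_castSucc o i)).trans
        (substTm_var _ _)))
  have e2 : compHom f (sectHom Y U o) (Fin.last Y.1) = substTm f o :=
    congrArg (substTm f) (sectSub_last o)
  change Judg.mor ⟨X.1, X.2, sTy (compHom f (sectHom Y U o)),
    compHom f (sectHom Y U o) (Fin.last Y.1)⟩ = _
  rw [e1, e2]

namespace IsRegularCongruence

variable {rOb : S.ob → S.ob → Prop} {rMor : S.mor → S.mor → Prop}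
variable (G : IsRegularCongruence S rOb rMor)

include G

/-- Related sections have related iterated lifts. The domains on the two sides differ, since each
application of `q` pulls the telescope back along its own tuple. -/
theorem rel_instVar {n k : ℕ} {Γ : Ctx LM n} {T : Ty LM n} {r r' : Tm R n}
    {Δ : Tele LM (n + 1) k}
    (hr : On rMor (Judg.mor ⟨n, Γ, T, r⟩) (Judg.mor ⟨n, Γ, T, r'⟩))
    (hΔ : ⟨n + 1 + k, (Γ.snoc T).append k Δ⟩ ∈ S.ob) :
    On rMor ⟨⟨n + k, Γ.append k (instTele LM r k Δ)⟩, ⟨n + 1 + k, (Γ.snoc T).append k Δ⟩,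
      instVar k r⟩ ⟨⟨n + k, Γ.append k (instTele LM r' k Δ)⟩,
        ⟨n + 1 + k, (Γ.snoc T).append k Δ⟩, instVar k r'⟩ := by
  induction k with
  | zero =>
    rw [instVar_zero, instVar_zero]
    exact hr
  | succ k ih =>
    obtain ⟨Δ, U⟩ := Δ
    rw [← liftSub_instVar, ← liftSub_instVar]
    exact G.rel_q _ ⟨n + 1 + k, (Γ.snoc T).append k Δ⟩ _ ⟨n + 1 + k, (Γ.snoc T).append k Δ⟩ _ _ U U
      (ih (S.ft_mem _ hΔ)) (On.refl G.equiv_ob hΔ)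

/-- The pullback of a section along `f` is `s` of the composite of `f` with it, so compatibility
with composition and `s` suffices. -/
theorem rel_pull_sec {X Y X' Y' : Ob LM} {f : Hom X Y} {f' : Hom X' Y'} {U : Ty LM Y.1}
    {U' : Ty LM Y'.1} {o : Tm R Y.1} {o' : Tm R Y'.1}
    (h : On rMor ⟨X, Y, f⟩ ⟨X', Y', f'⟩)
    (h' : On rMor (Judg.mor ⟨Y.1, Y.2, U, o⟩) (Judg.mor ⟨Y'.1, Y'.2, U', o'⟩)) :
    On rMor (Judg.mor ⟨X.1, X.2, substTy LM f U, substTm f o⟩)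
      (Judg.mor ⟨X'.1, X'.2, substTy LM f' U', substTm f' o'⟩) := by
  have h1 := G.rel_s _ _ _ _ _ _ _ _ (G.rel_comp _ _ _ _ _ _ _ _ _ _ h h')
  rw [← sHom_compHom_sectHom f U o, ← sHom_compHom_sectHom f' U' o']
  exact h1

end IsRegularCongruence

/-- The last variable is the section `s` of the identity of `(Γ, T)`. -/
theorem CSubsystem.var_mem (S : CSubsystem LM) {n : ℕ} {Γ : Ctx LM n} {T : Ty LM n}
    (hT : ⟨n + 1, Γ.snoc T⟩ ∈ S.ob) :
    ⟨n + 1, Γ.snoc T, wkTy LM n 0 T, var (Fin.last n)⟩ ∈ S.sec := by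
  have h := S.s_mem _ ⟨n, Γ⟩ T _ (S.id_mem ⟨n + 1, Γ.snoc T⟩ hT)
  have e : sTy (X := ⟨n + 1, Γ.snoc T⟩) (Y := ⟨n, Γ⟩) (T := T) (idHom ⟨n + 1, Γ.snoc T⟩) =
      wkTy LM n 0 T := by
    refine (sTy_eq _ _ _ _).trans ?_
    exact congrArg (fun f => substTy LM f T) (wkSub_zero n).symm
  have h' : (⟨n + 1, Γ.snoc T, sTy (X := ⟨n + 1, Γ.snoc T⟩) (Y := ⟨n, Γ⟩) (T := T)
    (idHom ⟨n + 1, Γ.snoc T⟩), var (Fin.last n)⟩ : Judg LM) ∈ S.sec := h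
  rwa [e] at h'

namespace IsSigmaRegular

variable {sim : S.ob → S.ob → Prop} {simeq : S.sec → S.sec → Prop}
variable (K : IsSigmaRegular S sim simeq)

include K

theorem isJudgementSystem :
    IsJudgementSystem S.ob S.sec (ofRelations S.ob S.sec (sim, simeq)).1
      (ofRelations S.ob S.sec (sim, simeq)).2 := by
  obtain ⟨rMor, G, hG⟩ := K.regular
  have toMor : ∀ {J J'}, On simeq J J' → On rMor J.mor J'.mor :=
    fun ⟨hJ, hJ', h⟩ => ⟨hJ, hJ', (hG _ _).1 h⟩
  have ofMor : ∀ {J J' : Judg LM}, On rMor J.mor J'.mor → On simeq J J' :=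
    fun ⟨hJ, hJ', h⟩ => ⟨hJ, hJ', (hG ⟨_, hJ⟩ ⟨_, hJ'⟩).2 h⟩
  have eOb := K.equiv_sim
  have eSec := K.equiv_simeq
  have ctx_mem : ∀ {n : ℕ} {Γ : Ctx LM n} {T : Ty LM n} {o : Tm R n},
      ⟨n, Γ, T, o⟩ ∈ S.sec → ⟨n, Γ⟩ ∈ S.ob := fun h => S.dom_mem _ h
  have ty_mem : ∀ {n : ℕ} {Γ : Ctx LM n} {T : Ty LM n} {o : Tm R n},
      ⟨n, Γ, T, o⟩ ∈ S.sec → ⟨n + 1, Γ.snoc T⟩ ∈ S.ob := fun h => S.cod_mem _ h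
  have ft_mem : ∀ {n : ℕ} {Γ : Ctx LM n} {T : Ty LM n},
      ⟨n + 1, Γ.snoc T⟩ ∈ S.ob → ⟨n, Γ⟩ ∈ S.ob := fun h => S.ft_mem _ h
  have wk_ty : ∀ {n k : ℕ} {Γ : Ctx LM n} {T : Ty LM n} {Δ : Tele LM n k} {U U' : Ty LM (n + k)},
      ⟨n + 1, Γ.snoc T⟩ ∈ S.ob →
      On sim ⟨n + k + 1, (Γ.append k Δ).snoc U⟩ ⟨n + k + 1, (Γ.append k Δ).snoc U'⟩ →
      On sim ⟨n + 1 + k + 1, ((Γ.snoc T).append k (wkTele LM n k Δ)).snoc (wkTy LM n k U)⟩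
        ⟨n + 1 + k + 1, ((Γ.snoc T).append k (wkTele LM n k Δ)).snoc (wkTy LM n k U')⟩ :=
    fun hT h => G.rel_pull _ _ _ _ _ _ _ _
      (On.refl G.equiv_mor (S.wkSub_mem hT (ft_mem h.left))) h
  have wk_tm : ∀ {n k : ℕ} {Γ : Ctx LM n} {T : Ty LM n} {Δ : Tele LM n k} {U : Ty LM (n + k)}
      {o o' : Tm R (n + k)}, ⟨n + 1, Γ.snoc T⟩ ∈ S.ob →
      On simeq ⟨n + k, Γ.append k Δ, U, o⟩ ⟨n + k, Γ.append k Δ, U, o'⟩ →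
      On simeq ⟨n + 1 + k, (Γ.snoc T).append k (wkTele LM n k Δ), wkTy LM n k U, wkTm n k o⟩
        ⟨n + 1 + k, (Γ.snoc T).append k (wkTele LM n k Δ), wkTy LM n k U, wkTm n k o'⟩ :=
    fun hT h => ofMor (G.rel_pull_sec
      (On.refl G.equiv_mor (S.wkSub_mem hT (ctx_mem h.left))) (toMor h))
  have inst_ty : ∀ {n k : ℕ} {Γ : Ctx LM n} {T : Ty LM n} {r r' : Tm R n}
      {Δ : Tele LM (n + 1) k} {U U' : Ty LM (n + 1 + k)},
      On simeq ⟨n, Γ, T, r⟩ ⟨n, Γ, T, r'⟩ →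
      On sim ⟨n + 1 + k + 1, ((Γ.snoc T).append k Δ).snoc U⟩
        ⟨n + 1 + k + 1, ((Γ.snoc T).append k Δ).snoc U'⟩ →
      On sim ⟨n + k + 1, (Γ.append k (instTele LM r k Δ)).snoc (instTy LM k r U)⟩
        ⟨n + k + 1, (Γ.append k (instTele LM r' k Δ)).snoc (instTy LM k r' U')⟩ :=
    fun hr h => G.rel_pull _ _ _ _ _ _ _ _ (G.rel_instVar (toMor hr) (ft_mem h.left)) h
  have inst_tm : ∀ {n k : ℕ} {Γ : Ctx LM n} {T : Ty LM n} {r r' : Tm R n}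
      {Δ : Tele LM (n + 1) k} {U : Ty LM (n + 1 + k)} {o o' : Tm R (n + 1 + k)},
      On simeq ⟨n, Γ, T, r⟩ ⟨n, Γ, T, r'⟩ →
      On simeq ⟨n + 1 + k, (Γ.snoc T).append k Δ, U, o⟩
        ⟨n + 1 + k, (Γ.snoc T).append k Δ, U, o'⟩ →
      On simeq ⟨n + k, Γ.append k (instTele LM r k Δ), instTy LM k r U, instTm k r o⟩
        ⟨n + k, Γ.append k (instTele LM r' k Δ), instTy LM k r' U, instTm k r' o'⟩ :=
    fun hr h => ofMor (G.rel_pull_sec (G.rel_instVar (toMor hr) (ctx_mem h.left)) (toMor h))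
  exact
  { c1_1 := S.pt_mem
    c1_2 n Γ T h := ft_mem h
    c1_3 n Γ T r h := ty_mem h
    -- Closure of term judgements is read off from the relational version applied to a reflexive
    -- pair.
    c1_4 n k Γ T Δ U r hT hr := (wk_tm hT (On.refl eSec hr)).left
    c1_5 n k Γ T s Δ U r hs hr := (inst_tm (On.refl eSec hs) (On.refl eSec hr)).left
    c1_6 n Γ T h := S.var_mem h
    c2_a n Γ T T' h := On.left h
    c2_b n Γ T h := On.refl eOb h
    c2_c n Γ T T' h := On.symm eOb h
    c2_d n Γ T T' T'' h h' := On.trans eOb h h'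
    c3_a n Γ T o o' h := On.left h
    c3_b n Γ T o h := On.refl eSec h
    c3_c n Γ T o o' h := On.symm eSec h
    c3_d n Γ T o o' o'' h h' := On.trans eSec h h'
    c4_a n k Γ T T' Δ U U' hT h := by
      -- Both ends of the equality over `(Γ, T, Δ)` are moved to `(Γ, T', Δ)` by `σ`, the left one
      -- backwards.
      have hΔ := K.conv_append (Δ := Δ) hT (ft_mem (On.left h))
      exact ((K.conv_ob hΔ (On.left h)).symm eOb).trans eOb
        (On.trans eOb h (K.conv_ob hΔ (On.right h)))
    c4_b n k Γ T T' Δ U o o' hT h := by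
      have hU := K.conv_ob (K.conv_append (Δ := Δ) hT (ctx_mem (On.left h)))
        (ty_mem (On.left h))
      exact ((K.conv_sec hU (On.left h)).symm eSec).trans eSec
        (On.trans eSec h (K.conv_sec hU (On.right h)))
    c4_c n Γ U U' o o' hU h :=
      ((K.conv_sec hU (On.left h)).symm eSec).trans eSec
        (On.trans eSec h (K.conv_sec hU (On.right h)))
    c5_a n k Γ T Δ U U' hT h := wk_ty hT h
    c5_b n k Γ T Δ U o o' hT h := wk_tm hT h
    c6_a n k Γ T r Δ U U' h hr := inst_ty (On.refl eSec hr) h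
    c6_b n k Γ T r Δ U o o' h hr := inst_tm (On.refl eSec hr) h
    c7_a n k Γ T r r' Δ U hU hr := by
      -- This relates `S[r]` over `Γ₂[r]` to `S[r']` over `Γ₂[r']`; the two contexts are related by
      -- `ft`, so `σ` brings the right-hand side back over `Γ₂[r]`.
      have h := inst_ty hr (On.refl eOb hU)
      exact h.trans eOb (K.conv_ob (On.symm eOb (G.rel_ft _ _ h)) h.right)
    c7_b n k Γ T r r' Δ U o ho hr := by
      have h := inst_tm hr (On.refl eSec ho)
      have h' := inst_ty hr (On.refl eOb (ty_mem ho))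
      -- For terms both the context and the type `S[r']` must be returned to those for `r`; `h''`
      -- relates the second context, extended by `S[r']`, over the first, and `h'` is the relation
      -- along which `σ̃` acts.
      have h'' := h'.trans eOb (K.conv_ob (On.symm eOb (G.rel_ft _ _ h')) h'.right)
      exact h.trans eSec (K.conv_sec (On.symm eOb h') h.right) }

end IsSigmaRegular

end OfRelations

end ContextCat

theorem proposition2014p07p10 {R : Type u → Type u} [Monad R] [LawfulMonad R]
    (LM : ContextCat.LeftModule R) (S : ContextCat.CSubsystem LM) :
    Set.BijOn (ContextCat.toRelations S.ob S.sec)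
      {E | ContextCat.IsJudgementSystem S.ob S.sec E.1 E.2}
      {r | ContextCat.IsSigmaRegular S r.1 r.2} ∧
    Set.MapsTo (ContextCat.ofRelations S.ob S.sec)
      {r | ContextCat.IsSigmaRegular S r.1 r.2}
      {E | ContextCat.IsJudgementSystem S.ob S.sec E.1 E.2} ∧
    Set.InvOn (ContextCat.ofRelations S.ob S.sec) (ContextCat.toRelations S.ob S.sec)
      {E | ContextCat.IsJudgementSystem S.ob S.sec E.1 E.2}
      {r | ContextCat.IsSigmaRegular S r.1 r.2} := by
  have hinv : Set.InvOn (ContextCat.ofRelations S.ob S.sec) (ContextCat.toRelations S.ob S.sec)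
      {E | ContextCat.IsJudgementSystem S.ob S.sec E.1 E.2}
      {r | ContextCat.IsSigmaRegular S r.1 r.2} :=
    ⟨fun _ H => ContextCat.ofRelations_toRelations S H, fun _ K => K.toRelations_ofRelations⟩
  have hmaps : Set.MapsTo (ContextCat.ofRelations S.ob S.sec)
      {r | ContextCat.IsSigmaRegular S r.1 r.2}
      {E | ContextCat.IsJudgementSystem S.ob S.sec E.1 E.2} := fun _ K => K.isJudgementSystem
  exact ⟨hinv.bijOn (fun _ H => S.isSigmaRegular H) hmaps, hmaps, hinv⟩
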